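/- Let $1\le p<\infty$ and let $H$ be an infinite-dimensional (complex) Hilbert space. For a bounded operator $T$ on $H$ and $k\ge 1$ put $s_k(T)=\inf\{\|T-R\|_{\mathrm{op}} : R \text{ bounded on } H,\ \operatorname{rank}(R)<k\}$, and let $\mathcal S_p(H)$ be the Schatten class of all bounded operators $T$ with $\|T\|_p:=\bigl(\sum_{k\ge1}s_k(T)^p\bigr)^{1/p}<\infty$, which is a Banach algebra under composition of operators and the norm $\|\cdot\|_p$. Then $\mathcal S_p(H)$ is not approximately amenable. Here a Banach algebra $\mathcal A$ is called approximately amenable if, for every Banach $\mathcal A$-bimodule $X$, every continuous derivation $D:\mathcal A\to X^*$ into the dual bimodule is approximately inner, i.e. there is a net $(x_i)$ in $X^*$ with $D(a)=\lim_i\,(a\cdot x_i-x_i\cdot a)$ in norm for every $a\in\mathcal A$. -/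

import Mathlib

universe u

/-! ### Singular numbers -/

/-- `approxNumber T n` is the distance, in the operator norm, from `T` to the operators of rank at
most `n`. Since `n` is counted from `0`, this is the singular number `s_{n+1}(T)`. -/
noncomputable def approxNumber {E F : Type u} [NormedAddCommGroup E] [InnerProductSpace ℂ E]
    [NormedAddCommGroup F] [InnerProductSpace ℂ F] (T : E →L[ℂ] F) (n : ℕ) : ℝ :=
  ⨅ R : {R : E →L[ℂ] F // LinearMap.rank (R : E →ₗ[ℂ] F) ≤ n}, ‖T - R.1‖

namespace approxNumber

section Basic

variable {E F G : Type u} [NormedAddCommGroup E] [InnerProductSpace ℂ E]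
  [NormedAddCommGroup F] [InnerProductSpace ℂ F] [NormedAddCommGroup G] [InnerProductSpace ℂ G]

lemma bdd (T : E →L[ℂ] F) (n : ℕ) : BddBelow (Set.range
    fun R : {R : E →L[ℂ] F // LinearMap.rank (R : E →ₗ[ℂ] F) ≤ n} => ‖T - R.1‖) :=
  ⟨0, by rintro _ ⟨R, rfl⟩; exact norm_nonneg _⟩

instance (n : ℕ) : Nonempty {R : E →L[ℂ] F // LinearMap.rank (R : E →ₗ[ℂ] F) ≤ n} :=
  ⟨⟨0, by simp⟩⟩

lemma nonneg (T : E →L[ℂ] F) (n : ℕ) : 0 ≤ approxNumber T n :=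
  Real.iInf_nonneg fun _ => norm_nonneg _

lemma le_norm_sub (T R : E →L[ℂ] F) (n : ℕ) (hR : LinearMap.rank (R : E →ₗ[ℂ] F) ≤ n) :
    approxNumber T n ≤ ‖T - R‖ :=
  ciInf_le (bdd T n) ⟨R, hR⟩

lemma exists_lt (T : E →L[ℂ] F) (n : ℕ) {c : ℝ} (h : approxNumber T n < c) :
    ∃ R : E →L[ℂ] F, LinearMap.rank (R : E →ₗ[ℂ] F) ≤ n ∧ ‖T - R‖ < c := by
  obtain ⟨R, hR⟩ := exists_lt_of_ciInf_lt h
  exact ⟨R.1, R.2, hR⟩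

lemma le_of_forall (T : E →L[ℂ] F) (n : ℕ) {c : ℝ}
    (h : ∀ R : E →L[ℂ] F, LinearMap.rank (R : E →ₗ[ℂ] F) ≤ n → c ≤ ‖T - R‖) :
    c ≤ approxNumber T n :=
  le_ciInf fun R => h R.1 R.2

lemma at_zero (T : E →L[ℂ] F) : approxNumber T 0 = ‖T‖ := by
  apply le_antisymm
  · simpa using le_norm_sub T 0 0 (by simp)
  · refine le_of_forall T 0 fun R hR => ?_
    have : (R : E →ₗ[ℂ] F) = 0 := by
      ext x
      have := Submodule.rank_eq_zero.mp (show Module.rank ℂ (LinearMap.range (R : E →ₗ[ℂ] F)) = 0 by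
        simpa using hR)
      have hx := LinearMap.mem_range_self (R : E →ₗ[ℂ] F) x
      rw [this] at hx
      simpa using hx
    have : R = 0 := by ext x; exact congrArg (fun f : E →ₗ[ℂ] F => f x) this
    simp [this]

lemma le_add_norm (S T : E →L[ℂ] F) (n : ℕ) :
    approxNumber S n ≤ approxNumber T n + ‖S - T‖ := by
  rw [← sub_le_iff_le_add]
  refine le_of_forall T n fun R hR => ?_
  have := le_norm_sub S R n hR
  have h2 : ‖S - R‖ ≤ ‖S - T‖ + ‖T - R‖ := norm_sub_le_norm_sub_add_norm_sub S T R
  linarith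

lemma comp_left_le (A : F →L[ℂ] G) (T : E →L[ℂ] F) (n : ℕ) :
    approxNumber (A ∘L T) n ≤ ‖A‖ * approxNumber T n := by
  rw [approxNumber, approxNumber, Real.mul_iInf_of_nonneg (norm_nonneg A)]
  refine le_ciInf fun R => ?_
  refine (le_norm_sub (A ∘L T) (A ∘L R.1) n ?_).trans ?_
  · exact (LinearMap.rank_comp_le_right (R.1 : E →ₗ[ℂ] F) (A : F →ₗ[ℂ] G)).trans R.2
  · rw [← ContinuousLinearMap.comp_sub]
    exact ContinuousLinearMap.opNorm_comp_le _ _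

lemma comp_right_le (T : F →L[ℂ] G) (A : E →L[ℂ] F) (n : ℕ) :
    approxNumber (T ∘L A) n ≤ approxNumber T n * ‖A‖ := by
  rw [approxNumber, approxNumber, Real.iInf_mul_of_nonneg (norm_nonneg A)]
  refine le_ciInf fun R => ?_
  refine (le_norm_sub (T ∘L A) (R.1 ∘L A) n ?_).trans ?_
  · exact (LinearMap.rank_comp_le_left (A : E →ₗ[ℂ] F) (R.1 : F →ₗ[ℂ] G)).trans R.2
  · rw [← ContinuousLinearMap.sub_comp]
    exact ContinuousLinearMap.opNorm_comp_le _ _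

lemma smul_le (c : ℂ) (T : E →L[ℂ] F) (n : ℕ) :
    approxNumber (c • T) n ≤ ‖c‖ * approxNumber T n := by
  have h := comp_left_le (c • ContinuousLinearMap.id ℂ F) T n
  have h1 : (c • ContinuousLinearMap.id ℂ F) ∘L T = c • T := by ext; simp
  rw [h1] at h
  refine h.trans (mul_le_mul_of_nonneg_right ?_ (nonneg T n))
  rw [norm_smul]
  exact mul_le_of_le_one_right (norm_nonneg c) ContinuousLinearMap.norm_id_le

lemma smul (c : ℂ) (T : E →L[ℂ] F) (n : ℕ) :
    approxNumber (c • T) n = ‖c‖ * approxNumber T n := by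
  rcases eq_or_ne c 0 with rfl | hc
  · exact le_antisymm (smul_le 0 T n) (by simpa using nonneg _ n)
  · refine le_antisymm (smul_le c T n) ?_
    have h := smul_le c⁻¹ (c • T) n
    rw [inv_smul_smul₀ hc, norm_inv] at h
    rwa [← le_inv_mul_iff₀ (norm_pos_iff.mpr hc)]

end Basic

section FiniteDimensional

variable {V : Type u} [NormedAddCommGroup V] [InnerProductSpace ℂ V] [FiniteDimensional ℂ V]

open Module

open scoped Classical in
/-- The right singular vectors of an operator on a finite-dimensional space. -/
lemma exists_basis (T : V →L[ℂ] V) : ∃ v : OrthonormalBasis (Fin (finrank ℂ V)) ℂ V,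
    ∀ i j, inner ℂ (T (v i)) (T (v j)) = if i = j then ((approxNumber T i ^ 2 : ℝ) : ℂ) else 0 := by
  have hT := LinearMap.isSymmetric_adjoint_comp_self (T : V →ₗ[ℂ] V)
  set v := hT.eigenvectorBasis rfl with hv
  set s : Fin (finrank ℂ V) → ℝ := fun i => LinearMap.singularValues (T : V →ₗ[ℂ] V) i with hs
  have hs0 : ∀ i, 0 ≤ s i := fun i => LinearMap.singularValues_nonneg _ _
  have hmono : ∀ i j : Fin (finrank ℂ V), i ≤ j → s j ≤ s i := fun i j hij =>
    LinearMap.singularValues_antitone (T : V →ₗ[ℂ] V) hij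
  have horth : ∀ i j, inner ℂ (T (v i)) (T (v j)) = if i = j then ((s i ^ 2 : ℝ) : ℂ) else 0 := by
    intro i j
    have h1 : inner ℂ (T (v i)) (T (v j)) =
        inner ℂ (v i) ((LinearMap.adjoint (T : V →ₗ[ℂ] V) ∘ₗ (T : V →ₗ[ℂ] V)) (v j)) := by
      rw [LinearMap.comp_apply, LinearMap.adjoint_inner_right]; rfl
    rw [h1, hv, hT.apply_eigenvectorBasis rfl j, inner_smul_right,
      orthonormal_iff_ite.mp (hT.eigenvectorBasis rfl).orthonormal i j]
    simp only [hs]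
    split_ifs with hij
    · subst hij
      rw [LinearMap.sq_singularValues_fin _ rfl]; simp
    · simp
  have hnorm : ∀ x, ‖T x‖ ^ 2 = ∑ i, s i ^ 2 * ‖inner ℂ (v i) x‖ ^ 2 := by
    intro x
    have hx : T x = ∑ i, inner ℂ (v i) x • T (v i) := by
      conv_lhs => rw [← v.sum_repr' x]
      simp
    have h2 : ((‖T x‖ ^ 2 : ℝ) : ℂ) = inner ℂ (T x) (T x) := by
      rw [inner_self_eq_norm_sq_to_K]; norm_cast
    have h3 : inner ℂ (T x) (T x) = ((∑ i, s i ^ 2 * ‖inner ℂ (v i) x‖ ^ 2 : ℝ) : ℂ) := by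
      rw [hx, sum_inner]
      push_cast
      refine Finset.sum_congr rfl fun i _ => ?_
      rw [inner_sum, Finset.sum_eq_single i]
      · rw [inner_smul_left, inner_smul_right, horth, if_pos rfl, ← mul_assoc, ← Complex.normSq_eq_conj_mul_self, Complex.normSq_eq_norm_sq]
        push_cast; ring
      · intro j _ hj
        rw [inner_smul_left, inner_smul_right, horth, if_neg (Ne.symm hj)]; simp
      · simp
    exact_mod_cast h2.trans h3
  have hparseval : ∀ x, ‖x‖ ^ 2 = ∑ i, ‖inner ℂ (v i) x‖ ^ 2 := fun x =>
    (v.sum_sq_norm_inner_right x).symm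
  have key : ∀ k : Fin (finrank ℂ V), approxNumber T k = s k := by
    intro k
    apply le_antisymm
    · set R : V →L[ℂ] V := ∑ i ∈ Finset.Iio k, (innerSL ℂ (v i)).smulRight (T (v i)) with hR
      refine (le_norm_sub T R k ?_).trans ?_
      · have hle : LinearMap.range (R : V →ₗ[ℂ] V) ≤
            Submodule.span ℂ (((Finset.Iio k).image fun i => T (v i) : Finset V) : Set V) := by
          rintro _ ⟨x, rfl⟩
          simp only [hR, ContinuousLinearMap.coe_coe, _root_.sum_apply,
            ContinuousLinearMap.smulRight_apply]
          refine Submodule.sum_mem _ fun i hi => Submodule.smul_mem _ _ (Submodule.subset_span ?_)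
          exact Finset.mem_coe.mpr (Finset.mem_image_of_mem _ hi)
        refine (Submodule.rank_mono hle).trans ((rank_span_finset_le _).trans ?_)
        exact_mod_cast Finset.card_image_le.trans (by simp)
      · refine ContinuousLinearMap.opNorm_le_bound _ (hs0 k) fun x => ?_
        have hy : (T - R) x = T (∑ i ∈ Finset.Ici k, inner ℂ (v i) x • v i) := by
          have hx : T x = ∑ i, inner ℂ (v i) x • T (v i) := by
            conv_lhs => rw [← v.sum_repr' x]
            simp
          rw [_root_.sub_apply, hx, hR, map_sum, sub_eq_iff_eq_add]
          simp only [_root_.sum_apply, ContinuousLinearMap.smulRight_apply,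
            innerSL_apply_apply, map_smul]
          rw [← Finset.sum_union]
          · congr 1; ext i; simp; exact le_or_gt k i
          · rw [Finset.disjoint_left]; intro i; simp
        have hin : ∀ j, inner ℂ (v j) (∑ i ∈ Finset.Ici k, inner ℂ (v i) x • v i) =
            if k ≤ j then inner ℂ (v j) x else 0 := by
          intro j
          simp [orthonormal_iff_ite.mp v.orthonormal]
        rw [← abs_of_nonneg (norm_nonneg ((T - R) x)), ← abs_of_nonneg (mul_nonneg (hs0 k) (norm_nonneg x)),
          ← sq_le_sq, hy, hnorm, mul_pow, hparseval x, Finset.mul_sum]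
        refine Finset.sum_le_sum fun j _ => ?_
        rw [hin]
        split_ifs with hkj
        · have := hmono k j hkj
          have := hs0 j
          gcongr
        · simp; positivity
    · refine le_of_forall T k fun R hR => ?_
      -- a vector in the span of the first `k + 1` singular vectors, killed by `R`
      set W := Submodule.span ℂ (Set.range fun i : Finset.Iic k => v i) with hW
      have hli : LinearIndependent ℂ fun i : Finset.Iic k => v i :=
        v.orthonormal.linearIndependent.comp _ Subtype.val_injective
      have hWf : finrank ℂ W = k + 1 := by
        rw [hW, finrank_span_eq_card hli, Fintype.card_coe, Fin.card_Iic]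
      have hRf : finrank ℂ (LinearMap.range (R : V →ₗ[ℂ] V)) ≤ k := by
        have : (finrank ℂ (LinearMap.range (R : V →ₗ[ℂ] V)) : Cardinal) ≤ k := by
          rw [finrank_eq_rank]; exact hR
        exact_mod_cast this
      have hker : LinearMap.ker ((R : V →ₗ[ℂ] V).rangeRestrict ∘ₗ W.subtype) ≠ ⊥ :=
        LinearMap.ker_ne_bot_of_finrank_lt (by omega)
      obtain ⟨⟨x, hxW⟩, hxk, hx0⟩ := (Submodule.ne_bot_iff _).mp hker
      have hRx : R x = 0 := by
        have := congrArg Subtype.val (LinearMap.mem_ker.mp hxk)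
        simpa using this
      have hx0 : x ≠ 0 := fun h => hx0 (Subtype.ext h)
      have hinx : ∀ j, k < j → inner ℂ (v j) x = 0 := by
        intro j hj
        refine Submodule.span_induction (p := fun y _ => inner ℂ (v j) y = 0) ?_ ?_ ?_ ?_ hxW
        · rintro _ ⟨i, rfl⟩
          have hi : i.1 ≤ k := Finset.mem_Iic.mp i.2
          exact v.orthonormal.2 (ne_of_gt (lt_of_le_of_lt hi hj))
        · simp
        · intro y z _ _ hy hz
          rw [inner_add_right, hy, hz, add_zero]
        · intro c y _ hy
          rw [inner_smul_right, hy, mul_zero]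
      have hle : s k * ‖x‖ ≤ ‖(T - R) x‖ := by
        rw [← abs_of_nonneg (norm_nonneg ((T - R) x)),
          ← abs_of_nonneg (mul_nonneg (hs0 k) (norm_nonneg x)), ← sq_le_sq, _root_.sub_apply, hRx,
          sub_zero, hnorm, mul_pow, hparseval x, Finset.mul_sum]
        refine Finset.sum_le_sum fun j _ => ?_
        rcases le_or_gt j k with hj | hj
        · have := hmono j k hj
          have := hs0 k
          gcongr
        · simp [hinx j hj]
      exact le_of_mul_le_mul_right (hle.trans ((T - R).le_opNorm x)) (norm_pos_iff.mpr hx0)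
  refine ⟨v, fun i j => ?_⟩
  rw [horth, key]

lemma of_finrank_le (T : V →L[ℂ] V) {n : ℕ} (hn : finrank ℂ V ≤ n) : approxNumber T n = 0 := by
  refine le_antisymm ?_ (nonneg T n)
  have := le_norm_sub T T n ((LinearMap.rank_le_domain (T : V →ₗ[ℂ] V)).trans
    (by rw [← finrank_eq_rank]; exact_mod_cast hn))
  simpa using this

lemma sum_mul_le_one {ι : Type*} (s : Finset ι) (a b : ι → ℝ) (ha : ∑ i ∈ s, a i ^ 2 ≤ 1)
    (hb : ∑ i ∈ s, b i ^ 2 ≤ 1) : ∑ i ∈ s, a i * b i ≤ 1 := by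
  have h : ∑ i ∈ s, a i * b i ≤ ∑ i ∈ s, (a i ^ 2 + b i ^ 2) / 2 :=
    Finset.sum_le_sum fun i _ => by nlinarith [sq_nonneg (a i - b i)]
  rw [← Finset.sum_div, Finset.sum_add_distrib] at h
  linarith

/-- The left singular vectors belonging to the nonzero singular numbers. -/
lemma exists_svd (T : V →L[ℂ] V) : ∃ (v : OrthonormalBasis (Fin (finrank ℂ V)) ℂ V)
    (u : Fin (finrank ℂ V) → V), (∀ k, T (v k) = (approxNumber T k : ℂ) • u k) ∧
      Orthonormal ℂ (fun k : {k : Fin (finrank ℂ V) // approxNumber T k ≠ 0} => u k) ∧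
      ∀ k : Fin (finrank ℂ V), approxNumber T k = 0 → u k = 0 := by
  classical
  obtain ⟨v, hv⟩ := exists_basis T
  refine ⟨v, fun k => ((approxNumber T k)⁻¹ : ℂ) • T (v k), fun k => ?_, ?_, fun k hk => by simp [hk]⟩
  · by_cases hk : approxNumber T k = 0
    · have := hv k k
      rw [if_pos rfl, hk] at this
      have : T (v k) = 0 := by
        rw [← inner_self_eq_zero (𝕜 := ℂ), this]; simp
      simp [this]
    · rw [smul_smul, mul_inv_cancel₀ (by exact_mod_cast hk), one_smul]
  · rw [orthonormal_iff_ite]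
    rintro ⟨i, hi⟩ ⟨j, hj⟩
    have hi' : (approxNumber T i : ℂ) ≠ 0 := by exact_mod_cast hi
    simp only [inner_smul_left, inner_smul_right, hv, Subtype.mk.injEq]
    split_ifs with h
    · subst h
      simp only [map_inv₀, Complex.conj_ofReal]
      push_cast
      field_simp
    · simp

lemma sum_inner_rpow_le (T : V →L[ℂ] V) {p : ℝ} (hp : 1 ≤ p) {ι : Type*} [Fintype ι]
    {e f : ι → V} (he : Orthonormal ℂ e) (hf : Orthonormal ℂ f) :
    ∑ i, ‖inner ℂ (f i) (T (e i))‖ ^ p ≤ ∑ k : Fin (finrank ℂ V), approxNumber T k ^ p := by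
  classical
  obtain ⟨v, u, hTv, hu, hu0⟩ := exists_svd T
  have hp0 : 0 < p := by linarith
  set s : Fin (finrank ℂ V) → ℝ := fun k => approxNumber T k with hs
  have hs0 : ∀ k, 0 ≤ s k := fun k => nonneg T k
  set w : ι → Fin (finrank ℂ V) → ℝ := fun i k => ‖inner ℂ (v k) (e i)‖ * ‖inner ℂ (f i) (u k)‖ with hw
  have hw0 : ∀ i k, 0 ≤ w i k := fun i k => by positivity
  have hrow : ∀ i, ∑ k, w i k ≤ 1 := by
    intro i
    refine sum_mul_le_one _ _ _ ?_ ?_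
    · rw [v.sum_sq_norm_inner_right, he.1 i]; norm_num
    · have h1 := hu.sum_inner_products_le (x := f i) (s := Finset.univ)
      rw [hf.1 i] at h1
      rw [← Finset.sum_subset (Finset.subset_univ (Finset.univ.filter fun k => s k ≠ 0)),
        Finset.sum_subtype (p := fun k : Fin (finrank ℂ V) => approxNumber T k ≠ 0)]
      · refine le_trans (le_of_eq (Finset.sum_congr rfl fun k _ => ?_)) (h1.trans (by norm_num))
        rw [norm_inner_symm]
      · intro k; simp [hs]
      · intro k _ hk
        have : s k = 0 := by simpa using hk
        simp [hu0 k this]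
  have hcol : ∀ k, ∑ i, w i k ≤ 1 := by
    intro k
    refine sum_mul_le_one _ _ _ ?_ ?_
    · have h1 := he.sum_inner_products_le (x := v k) (s := Finset.univ)
      rw [v.orthonormal.1 k] at h1
      refine le_trans (le_of_eq (Finset.sum_congr rfl fun i _ => ?_)) (h1.trans (by norm_num))
      rw [norm_inner_symm]
    · have h1 := hf.sum_inner_products_le (x := u k) (s := Finset.univ)
      refine h1.trans ?_
      by_cases hk : approxNumber T k = 0
      · simp [hu0 k hk]
      · rw [hu.1 ⟨k, hk⟩]; norm_num
  have hterm : ∀ i, ‖inner ℂ (f i) (T (e i))‖ ^ p ≤ ∑ k, w i k * s k ^ p := by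
    intro i
    have h1 : ‖inner ℂ (f i) (T (e i))‖ ≤ ∑ k, w i k * s k := by
      have hx : T (e i) = ∑ k, inner ℂ (v k) (e i) • T (v k) := by
        conv_lhs => rw [← v.sum_repr' (e i)]
        simp
      rw [hx, inner_sum]
      refine (norm_sum_le _ _).trans (Finset.sum_le_sum fun k _ => le_of_eq ?_)
      rw [hTv, inner_smul_right, inner_smul_right, norm_mul, norm_mul, Complex.norm_real,
        Real.norm_of_nonneg (hs0 k)]
      simp only [hw, hs]; ring
    have h2 := Real.inner_le_weight_mul_Lp_of_nonneg Finset.univ hp (w i) s (hw0 i) hs0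
    have h3 : (∑ k, w i k) ^ (1 - p⁻¹) ≤ 1 :=
      Real.rpow_le_one (Finset.sum_nonneg fun k _ => hw0 i k) (hrow i)
        (by rw [sub_nonneg]; exact inv_le_one_of_one_le₀ hp)
    have h40 : 0 ≤ ∑ k, w i k * s k ^ p :=
      Finset.sum_nonneg fun k _ => mul_nonneg (hw0 i k) (Real.rpow_nonneg (hs0 k) p)
    have h4 : ‖inner ℂ (f i) (T (e i))‖ ≤ (∑ k, w i k * s k ^ p) ^ p⁻¹ :=
      (h1.trans h2).trans (mul_le_of_le_one_left (Real.rpow_nonneg h40 _) h3)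
    calc _ ≤ ((∑ k, w i k * s k ^ p) ^ p⁻¹) ^ p := Real.rpow_le_rpow (norm_nonneg _) h4 hp0.le
      _ = _ := Real.rpow_inv_rpow h40 hp0.ne'
  calc _ ≤ ∑ i, ∑ k, w i k * s k ^ p := Finset.sum_le_sum fun i _ => hterm i
    _ = ∑ k, (∑ i, w i k) * s k ^ p := by
      rw [Finset.sum_comm]; simp_rw [Finset.sum_mul]
    _ ≤ ∑ k, s k ^ p := Finset.sum_le_sum fun k _ =>
      mul_le_of_le_one_left (Real.rpow_nonneg (hs0 k) p) (hcol k)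

lemma add_le_finiteDimensional (S T : V →L[ℂ] V) {p : ℝ} (hp : 1 ≤ p) :
    (∑ k : Fin (finrank ℂ V), approxNumber (S + T) k ^ p) ^ (1 / p) ≤
      (∑ k : Fin (finrank ℂ V), approxNumber S k ^ p) ^ (1 / p) +
        (∑ k : Fin (finrank ℂ V), approxNumber T k ^ p) ^ (1 / p) := by
  classical
  obtain ⟨v, u, hv, hu, hu0⟩ := exists_svd (S + T)
  have hp0 : 0 < p := by linarith
  set J := {k : Fin (finrank ℂ V) // approxNumber (S + T) k ≠ 0} with hJ
  have he : Orthonormal ℂ (fun k : J => v k) := v.orthonormal.comp _ Subtype.val_injective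
  have h1 : ∑ k : Fin (finrank ℂ V), approxNumber (S + T) k ^ p =
      ∑ k : J, ‖inner ℂ (u k) ((S + T) (v k))‖ ^ p := by
    rw [← Finset.sum_subset (Finset.subset_univ (Finset.univ.filter
        fun k : Fin (finrank ℂ V) => approxNumber (S + T) k ≠ 0)),
      Finset.sum_subtype (p := fun k : Fin (finrank ℂ V) => approxNumber (S + T) k ≠ 0)]
    · refine Finset.sum_congr rfl fun k _ => ?_
      have hk := hu.1 k
      simp only at hk
      rw [hv, inner_smul_right, inner_self_eq_norm_sq_to_K, hk, norm_mul, Complex.norm_real,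
        Real.norm_of_nonneg (nonneg _ _)]
      simp
    · intro k; simp
    · intro k _ hk
      have : approxNumber (S + T) k = 0 := by simpa using hk
      rw [this, Real.zero_rpow hp0.ne']
  rw [h1]
  calc _ ≤ (∑ k : J, (‖inner ℂ (u k) (S (v k))‖ + ‖inner ℂ (u k) (T (v k))‖) ^ p) ^ (1 / p) := by
        refine Real.rpow_le_rpow (Finset.sum_nonneg fun k _ => by positivity)
          (Finset.sum_le_sum fun k _ => Real.rpow_le_rpow (norm_nonneg _) ?_ hp0.le) (by positivity)
        rw [_root_.add_apply, inner_add_right]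
        exact norm_add_le _ _
    _ ≤ (∑ k : J, ‖inner ℂ (u k) (S (v k))‖ ^ p) ^ (1 / p) +
        (∑ k : J, ‖inner ℂ (u k) (T (v k))‖ ^ p) ^ (1 / p) :=
      Real.Lp_add_le_of_nonneg _ hp (fun _ _ => norm_nonneg _) (fun _ _ => norm_nonneg _)
    _ ≤ _ := by
      have hS := sum_inner_rpow_le S hp he hu
      have hT := sum_inner_rpow_le T hp he hu
      exact add_le_add
        (Real.rpow_le_rpow (Finset.sum_nonneg fun k _ => by positivity) hS (by positivity))
        (Real.rpow_le_rpow (Finset.sum_nonneg fun k _ => by positivity) hT (by positivity))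

end FiniteDimensional

section Compression

variable {H : Type u} [NormedAddCommGroup H] [InnerProductSpace ℂ H]

/-- The compression of `T` to a finite-dimensional subspace. -/
noncomputable def compress (W : Submodule ℂ H) [FiniteDimensional ℂ W] (T : H →L[ℂ] H) :
    W →L[ℂ] W :=
  W.orthogonalProjectionOnto ∘L T ∘L W.subtypeL

lemma compress_le (W : Submodule ℂ H) [FiniteDimensional ℂ W] (T : H →L[ℂ] H) (n : ℕ) :
    approxNumber (compress W T) n ≤ approxNumber T n := by
  refine (comp_left_le _ _ n).trans ((mul_le_of_le_one_left (nonneg _ n)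
    W.orthogonalProjectionOnto_norm_le).trans ((comp_right_le _ _ n).trans
      (mul_le_of_le_one_right (nonneg _ n) W.norm_subtypeL_le)))

lemma le_compress_add [CompleteSpace H] (T R : H →L[ℂ] H)
    (hR : FiniteDimensional ℂ (LinearMap.range (R : H →ₗ[ℂ] H))) :
    ∃ (W : Submodule ℂ H) (_ : FiniteDimensional ℂ W), ∀ n,
      approxNumber T n ≤ approxNumber (compress W T) n + 2 * ‖T - R‖ := by
  set V := LinearMap.range (R : H →ₗ[ℂ] H) with hV
  set W := V ⊔ V.map ((ContinuousLinearMap.adjoint R : H →L[ℂ] H) : H →ₗ[ℂ] H) with hW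
  have hWf : FiniteDimensional ℂ W := inferInstance
  refine ⟨W, hWf, fun n => ?_⟩
  set P : H →L[ℂ] H := W.subtypeL ∘L W.orthogonalProjectionOnto with hP
  have hP1 : ‖P‖ ≤ 1 := by
    refine (ContinuousLinearMap.opNorm_comp_le _ _).trans ?_
    exact mul_le_one₀ W.norm_subtypeL_le (norm_nonneg _) W.orthogonalProjectionOnto_norm_le
  have hRV : ∀ x, R x ∈ V := fun x => LinearMap.mem_range_self (R : H →ₗ[ℂ] H) x
  have hPR : P ∘L R = R := by
    ext x
    have : R x ∈ W := (le_sup_left : V ≤ W) (hRV x)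
    simpa [hP] using W.starProjection_eq_self_iff.mpr this
  have hRP : R ∘L P = R := by
    ext x
    have hx : x - P x ∈ Wᗮ := by simp [hP]
    have h0 : R (x - P x) = 0 := by
      rw [← inner_self_eq_zero (𝕜 := ℂ), ← ContinuousLinearMap.adjoint_inner_right]
      refine Submodule.inner_left_of_mem_orthogonal ?_ hx
      exact (le_sup_right : _ ≤ W) (Submodule.mem_map_of_mem (hRV _))
    rw [map_sub, sub_eq_zero] at h0
    exact h0.symm
  have h1 : T - W.subtypeL ∘L compress W T ∘L W.orthogonalProjectionOnto =
      (T - R) - P ∘L (T - R) ∘L P := by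
    have : W.subtypeL ∘L compress W T ∘L W.orthogonalProjectionOnto = P ∘L T ∘L P := rfl
    rw [this, ContinuousLinearMap.sub_comp, ContinuousLinearMap.comp_sub, hRP, hPR]
    abel
  have h2 : ‖T - W.subtypeL ∘L compress W T ∘L W.orthogonalProjectionOnto‖ ≤ 2 * ‖T - R‖ := by
    rw [h1]
    refine (norm_sub_le _ _).trans ?_
    have h3 : ‖P ∘L (T - R) ∘L P‖ ≤ ‖T - R‖ := by
      refine (ContinuousLinearMap.opNorm_comp_le _ _).trans
        ((mul_le_of_le_one_left (norm_nonneg _) hP1).trans ?_)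
      exact (ContinuousLinearMap.opNorm_comp_le _ _).trans
        (mul_le_of_le_one_right (norm_nonneg _) hP1)
    linarith
  refine (le_add_norm T _ n).trans (add_le_add ?_ h2)
  exact (comp_left_le _ _ n).trans ((mul_le_of_le_one_left (nonneg _ n)
    W.norm_subtypeL_le).trans ((comp_right_le _ _ n).trans
      (mul_le_of_le_one_right (nonneg _ n) W.orthogonalProjectionOnto_norm_le)))

end Compression

end approxNumber

/-! ### The Schatten classes -/

section Schatten

variable {p : ℝ} {H : Type u} [NormedAddCommGroup H] [InnerProductSpace ℂ H]

/-- `T` belongs to the Schatten `p`-class: its singular numbers are `p`-summable. -/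
def MemSchatten (p : ℝ) (T : H →L[ℂ] H) : Prop :=
  Summable fun n => approxNumber T n ^ p

/-- The Schatten `p`-norm `(∑ s_k(T) ^ p) ^ (1 / p)`. -/
noncomputable def schattenNorm (p : ℝ) (T : H →L[ℂ] H) : ℝ :=
  (∑' n, approxNumber T n ^ p) ^ (1 / p)

lemma schattenNorm_nonneg (T : H →L[ℂ] H) : 0 ≤ schattenNorm p T :=
  Real.rpow_nonneg (tsum_nonneg fun n => Real.rpow_nonneg (approxNumber.nonneg T n) p) _

lemma sum_le_schattenNorm (hp : 1 ≤ p) {T : H →L[ℂ] H} (hT : MemSchatten p T) (s : Finset ℕ) :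
    (∑ n ∈ s, approxNumber T n ^ p) ^ (1 / p) ≤ schattenNorm p T := by
  have h0 : ∀ n, 0 ≤ approxNumber T n ^ p := fun n => Real.rpow_nonneg (approxNumber.nonneg T n) p
  exact Real.rpow_le_rpow (Finset.sum_nonneg fun n _ => h0 n)
    (hT.sum_le_tsum s fun n _ => h0 n) (by positivity)

lemma memSchatten_of_sum_le (hp : 1 ≤ p) {T : H →L[ℂ] H} {C : ℝ}
    (h : ∀ n, (∑ k ∈ Finset.range n, approxNumber T k ^ p) ^ (1 / p) ≤ C) :
    MemSchatten p T ∧ schattenNorm p T ≤ C := by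
  have hp0 : 0 < p := by linarith
  have h0 : ∀ n, 0 ≤ approxNumber T n ^ p := fun n => Real.rpow_nonneg (approxNumber.nonneg T n) p
  have hC : 0 ≤ C := le_trans (Real.rpow_nonneg (Finset.sum_nonneg fun k _ => h0 k) _) (h 0)
  have h' : ∀ n, ∑ k ∈ Finset.range n, approxNumber T k ^ p ≤ C ^ p := fun n =>
    (Real.rpow_inv_le_iff_of_pos (Finset.sum_nonneg fun k _ => h0 k) hC hp0).mp
      (by simpa using h n)
  refine ⟨summable_of_sum_range_le h0 h', ?_⟩
  have := Real.tsum_le_of_sum_range_le h0 h'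
  rw [schattenNorm, one_div]
  exact (Real.rpow_inv_le_iff_of_pos (tsum_nonneg h0) hC hp0).mpr this

lemma norm_le_schattenNorm (hp : 1 ≤ p) {T : H →L[ℂ] H} (hT : MemSchatten p T) :
    ‖T‖ ≤ schattenNorm p T := by
  have hp0 : 0 < p := by linarith
  have := sum_le_schattenNorm hp hT {0}
  rwa [Finset.sum_singleton, one_div, Real.rpow_rpow_inv (approxNumber.nonneg T 0) hp0.ne',
    approxNumber.at_zero] at this

lemma MemSchatten.exists_finiteRank (hp : 1 ≤ p) {T : H →L[ℂ] H} (hT : MemSchatten p T) {ε : ℝ}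
    (hε : 0 < ε) : ∃ (R : H →L[ℂ] H), FiniteDimensional ℂ (LinearMap.range (R : H →ₗ[ℂ] H)) ∧
      ‖T - R‖ < ε := by
  have hp0 : 0 < p := by linarith
  obtain ⟨n, hn⟩ := (hT.tendsto_atTop_zero.eventually_lt_const (Real.rpow_pos_of_pos hε p)).exists
  obtain ⟨R, hR, hTR⟩ := approxNumber.exists_lt T n
    ((Real.rpow_lt_rpow_iff (approxNumber.nonneg T n) hε.le hp0).mp hn)
  refine ⟨R, ?_, hTR⟩
  exact Module.rank_lt_aleph0_iff.mp (lt_of_le_of_lt hR (Cardinal.natCast_lt_aleph0))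

lemma sum_approxNumber_add_le [CompleteSpace H] (hp : 1 ≤ p) {S T : H →L[ℂ] H} (hS : MemSchatten p S)
    (hT : MemSchatten p T) (n : ℕ) :
    (∑ k ∈ Finset.range n, approxNumber (S + T) k ^ p) ^ (1 / p) ≤
      schattenNorm p S + schattenNorm p T := by
  have hp0 : 0 < p := by linarith
  have hstep : ∀ ε > 0, (∑ k ∈ Finset.range n, approxNumber (S + T) k ^ p) ^ (1 / p) ≤
      schattenNorm p S + schattenNorm p T + (n : ℝ) ^ (1 / p) * (4 * ε) := by
    intro ε hε
    obtain ⟨R₁, hR₁, h1⟩ := hS.exists_finiteRank hp hε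
    obtain ⟨R₂, hR₂, h2⟩ := hT.exists_finiteRank hp hε
    have hR : FiniteDimensional ℂ (LinearMap.range ((R₁ + R₂ : H →L[ℂ] H) : H →ₗ[ℂ] H)) :=
      Submodule.finiteDimensional_of_le
        (LinearMap.range_add_le (R₁ : H →ₗ[ℂ] H) (R₂ : H →ₗ[ℂ] H))
    obtain ⟨W, hW, hle⟩ := approxNumber.le_compress_add (S + T) (R₁ + R₂) hR
    have hd : ‖S + T - (R₁ + R₂)‖ ≤ 2 * ε := by
      have : S + T - (R₁ + R₂) = (S - R₁) + (T - R₂) := by abel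
      rw [this]
      exact (norm_add_le _ _).trans (by linarith)
    have hcadd : approxNumber.compress W (S + T) =
        approxNumber.compress W S + approxNumber.compress W T := by
      simp [approxNumber.compress, ContinuousLinearMap.add_comp, ContinuousLinearMap.comp_add]
    have hfin : ∀ A : H →L[ℂ] H, MemSchatten p A →
        (∑ k : Fin (Module.finrank ℂ W), approxNumber (approxNumber.compress W A) k ^ p) ^ (1 / p)
          ≤ schattenNorm p A := by
      intro A hA
      refine le_trans ?_ (sum_le_schattenNorm hp hA (Finset.range (Module.finrank ℂ W)))
      rw [Finset.sum_range]
      refine Real.rpow_le_rpow (Finset.sum_nonneg fun k _ => Real.rpow_nonneg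
        (approxNumber.nonneg _ _) p) (Finset.sum_le_sum fun k _ => ?_) (by positivity)
      exact Real.rpow_le_rpow (approxNumber.nonneg _ _) (approxNumber.compress_le W A k) hp0.le
    have htrunc : ∑ k ∈ Finset.range n, approxNumber (approxNumber.compress W (S + T)) k ^ p ≤
        ∑ k : Fin (Module.finrank ℂ W), approxNumber (approxNumber.compress W (S + T)) k ^ p := by
      rw [← Finset.sum_range (fun k => approxNumber (approxNumber.compress W (S + T)) k ^ p)]
      rw [← Finset.sum_filter_of_ne (p := fun k => k < Module.finrank ℂ W)]
      · refine Finset.sum_le_sum_of_subset_of_nonneg (fun k hk => ?_) fun k _ _ =>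
          Real.rpow_nonneg (approxNumber.nonneg _ _) p
        exact Finset.mem_range.mpr (Finset.mem_filter.mp hk).2
      · intro k _ hk
        by_contra hcon
        exact hk (by rw [approxNumber.of_finrank_le _ (not_lt.mp hcon), Real.zero_rpow hp0.ne'])
    calc (∑ k ∈ Finset.range n, approxNumber (S + T) k ^ p) ^ (1 / p)
        ≤ (∑ k ∈ Finset.range n,
            (approxNumber (approxNumber.compress W (S + T)) k + 4 * ε) ^ p) ^ (1 / p) := by
          refine Real.rpow_le_rpow (Finset.sum_nonneg fun k _ => Real.rpow_nonneg
            (approxNumber.nonneg _ _) p) (Finset.sum_le_sum fun k _ => ?_) (by positivity)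
          exact Real.rpow_le_rpow (approxNumber.nonneg _ _) ((hle k).trans (by linarith)) hp0.le
      _ ≤ (∑ k ∈ Finset.range n,
            approxNumber (approxNumber.compress W (S + T)) k ^ p) ^ (1 / p) +
          (∑ k ∈ Finset.range n, (4 * ε) ^ p) ^ (1 / p) :=
        Real.Lp_add_le_of_nonneg _ hp (fun _ _ => approxNumber.nonneg _ _)
          (fun _ _ => by positivity)
      _ ≤ (schattenNorm p S + schattenNorm p T) + (n : ℝ) ^ (1 / p) * (4 * ε) := by
        refine add_le_add ?_ (le_of_eq ?_)
        · refine (Real.rpow_le_rpow (Finset.sum_nonneg fun k _ => Real.rpow_nonneg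
            (approxNumber.nonneg _ _) p) htrunc (by positivity)).trans ?_
          rw [hcadd]
          exact (approxNumber.add_le_finiteDimensional _ _ hp).trans
            (add_le_add (hfin S hS) (hfin T hT))
        · rw [Finset.sum_const, Finset.card_range, nsmul_eq_mul,
            Real.mul_rpow (by positivity) (by positivity), one_div,
            Real.rpow_rpow_inv (by positivity) hp0.ne']
  have hlim : Filter.Tendsto (fun ε : ℝ => schattenNorm p S + schattenNorm p T +
      (n : ℝ) ^ (1 / p) * (4 * ε)) (nhdsWithin 0 (Set.Ioi 0))
        (nhds (schattenNorm p S + schattenNorm p T)) := by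
    have : Continuous fun ε : ℝ => schattenNorm p S + schattenNorm p T +
      (n : ℝ) ^ (1 / p) * (4 * ε) := by fun_prop
    simpa using (this.tendsto 0).mono_left nhdsWithin_le_nhds
  exact ge_of_tendsto hlim (Filter.eventually_of_mem self_mem_nhdsWithin hstep)

lemma MemSchatten.add [CompleteSpace H] (hp : 1 ≤ p) {S T : H →L[ℂ] H} (hS : MemSchatten p S)
    (hT : MemSchatten p T) : MemSchatten p (S + T) :=
  (memSchatten_of_sum_le hp (sum_approxNumber_add_le hp hS hT)).1

lemma schattenNorm_add_le [CompleteSpace H] (hp : 1 ≤ p) {S T : H →L[ℂ] H}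
    (hS : MemSchatten p S) (hT : MemSchatten p T) :
    schattenNorm p (S + T) ≤ schattenNorm p S + schattenNorm p T :=
  (memSchatten_of_sum_le hp (sum_approxNumber_add_le hp hS hT)).2

lemma MemSchatten.zero (hp : 1 ≤ p) : MemSchatten p (0 : H →L[ℂ] H) := by
  have h : ∀ n, approxNumber (0 : H →L[ℂ] H) n = 0 := fun n =>
    le_antisymm (by simpa using approxNumber.le_norm_sub (0 : H →L[ℂ] H) 0 n (by simp))
      (approxNumber.nonneg _ n)
  have hp0 : p ≠ 0 := by linarith
  simp only [MemSchatten, h, Real.zero_rpow hp0]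
  exact summable_zero

lemma MemSchatten.smul (c : ℂ) {T : H →L[ℂ] H} (hT : MemSchatten p T) :
    MemSchatten p (c • T) := by
  simp only [MemSchatten, approxNumber.smul,
    Real.mul_rpow (norm_nonneg c) (approxNumber.nonneg T _)]
  exact hT.mul_left _

lemma schattenNorm_smul (hp : 1 ≤ p) (c : ℂ) (T : H →L[ℂ] H) :
    schattenNorm p (c • T) = ‖c‖ * schattenNorm p T := by
  have hp0 : p ≠ 0 := by linarith
  simp only [schattenNorm, approxNumber.smul,
    Real.mul_rpow (norm_nonneg c) (approxNumber.nonneg T _)]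
  rw [tsum_mul_left, Real.mul_rpow (Real.rpow_nonneg (norm_nonneg c) p)
    (tsum_nonneg fun n => Real.rpow_nonneg (approxNumber.nonneg T n) p), one_div,
    Real.rpow_rpow_inv (norm_nonneg c) hp0]

lemma sum_approxNumber_mul_le (hp : 1 ≤ p) (S : H →L[ℂ] H) {T : H →L[ℂ] H} (hT : MemSchatten p T) (n : ℕ) :
    (∑ k ∈ Finset.range n, approxNumber (S * T) k ^ p) ^ (1 / p) ≤ ‖S‖ * schattenNorm p T := by
  have hp0 : 0 < p := by linarith
  refine le_trans (Real.rpow_le_rpow (Finset.sum_nonneg fun k _ => Real.rpow_nonneg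
    (approxNumber.nonneg _ _) p) (Finset.sum_le_sum fun k _ => Real.rpow_le_rpow
      (approxNumber.nonneg _ _) (approxNumber.comp_left_le S T k) hp0.le) (by positivity)) ?_
  simp only [Real.mul_rpow (norm_nonneg S) (approxNumber.nonneg T _)]
  rw [← Finset.mul_sum, Real.mul_rpow (Real.rpow_nonneg (norm_nonneg S) p)
    (Finset.sum_nonneg fun n _ => Real.rpow_nonneg (approxNumber.nonneg T n) p)]
  refine mul_le_mul (le_of_eq ?_) (sum_le_schattenNorm hp hT _) (Real.rpow_nonneg
    (Finset.sum_nonneg fun n _ => Real.rpow_nonneg (approxNumber.nonneg T n) p) _) (norm_nonneg _)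
  rw [one_div, Real.rpow_rpow_inv (norm_nonneg S) hp0.ne']

lemma MemSchatten.mul (hp : 1 ≤ p) (S : H →L[ℂ] H) {T : H →L[ℂ] H} (hT : MemSchatten p T) :
    MemSchatten p (S * T) :=
  (memSchatten_of_sum_le hp (sum_approxNumber_mul_le hp S hT)).1

lemma schattenNorm_mul_le (hp : 1 ≤ p) {S T : H →L[ℂ] H} (hS : MemSchatten p S)
    (hT : MemSchatten p T) : schattenNorm p (S * T) ≤ schattenNorm p S * schattenNorm p T :=
  (memSchatten_of_sum_le hp (sum_approxNumber_mul_le hp S hT)).2.trans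
    (mul_le_mul_of_nonneg_right (norm_le_schattenNorm hp hS) (schattenNorm_nonneg T))

variable (p H)

/-- The Schatten class operators, as a subalgebra of the bounded operators on `H`. -/
def schattenSubalgebra [CompleteSpace H] [hp : Fact (1 ≤ p)] :
    NonUnitalSubalgebra ℂ (H →L[ℂ] H) where
  carrier := {T | MemSchatten p T}
  add_mem' hS hT := MemSchatten.add hp.out hS hT
  zero_mem' := MemSchatten.zero hp.out
  mul_mem' {S _} _ hT := MemSchatten.mul hp.out S hT
  smul_mem' c _ hT := MemSchatten.smul c hT

/-- The Schatten class `S_p(H)`. It is a type synonym, so that it carries the Schatten norm and not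
the operator norm. -/
def SchattenClass [CompleteSpace H] [Fact (1 ≤ p)] : Type u := schattenSubalgebra p H

namespace SchattenClass

variable [CompleteSpace H] [hp : Fact (1 ≤ p)]

instance : NonUnitalRing (SchattenClass p H) := inferInstanceAs (NonUnitalRing (schattenSubalgebra p H))

instance : Module ℂ (SchattenClass p H) := inferInstanceAs (Module ℂ (schattenSubalgebra p H))

instance : IsScalarTower ℂ (SchattenClass p H) (SchattenClass p H) :=
  inferInstanceAs (IsScalarTower ℂ (schattenSubalgebra p H) (schattenSubalgebra p H))

instance : SMulCommClass ℂ (SchattenClass p H) (SchattenClass p H) :=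
  inferInstanceAs (SMulCommClass ℂ (schattenSubalgebra p H) (schattenSubalgebra p H))

variable {p H}

/-- The bounded operator underlying an element of the Schatten class. -/
def toCLM (T : SchattenClass p H) : H →L[ℂ] H := Subtype.val T

/-- A bounded operator in the Schatten class, as an element of the type `SchattenClass p H`. -/
def ofMem (T : H →L[ℂ] H) (hT : MemSchatten p T) : SchattenClass p H := Subtype.mk T hT

lemma memSchatten (T : SchattenClass p H) : MemSchatten p T.toCLM := Subtype.property T

lemma toCLM_injective : Function.Injective (toCLM : SchattenClass p H → H →L[ℂ] H) :=
  Subtype.val_injective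

noncomputable instance : Norm (SchattenClass p H) := ⟨fun T => schattenNorm p T.toCLM⟩

lemma norm_def (T : SchattenClass p H) : ‖T‖ = schattenNorm p T.toCLM := rfl

lemma normCore : NormedSpace.Core ℂ (SchattenClass p H) where
  norm_nonneg T := schattenNorm_nonneg T.toCLM
  norm_smul c T := schattenNorm_smul hp.out c T.toCLM
  norm_triangle S T := schattenNorm_add_le hp.out S.memSchatten T.memSchatten
  norm_eq_zero_iff T := by
    constructor
    · intro h
      have := norm_le_schattenNorm hp.out T.memSchatten
      rw [← norm_def, h] at this
      exact toCLM_injective (norm_le_zero_iff.mp this)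
    · rintro rfl
      have := schattenNorm_smul hp.out 0 (0 : H →L[ℂ] H)
      rw [norm_zero, zero_mul, smul_zero] at this
      exact this

noncomputable instance : NonUnitalNormedRing (SchattenClass p H) :=
  { (inferInstance : NonUnitalRing (SchattenClass p H)), NormedAddCommGroup.ofCore normCore with
    norm_mul_le := fun S T => schattenNorm_mul_le hp.out S.memSchatten T.memSchatten }

noncomputable instance : NormedSpace ℂ (SchattenClass p H) := NormedSpace.ofCore normCore

instance : CompleteSpace (SchattenClass p H) := by
  refine Metric.complete_of_cauchySeq_tendsto fun u hu => ?_
  have hsub : ∀ i j, (u i - u j).toCLM = (u i).toCLM - (u j).toCLM := fun i j => rfl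
  rw [Metric.cauchySeq_iff] at hu
  have hop : CauchySeq fun n => (u n).toCLM := by
    rw [Metric.cauchySeq_iff]
    intro ε hε
    obtain ⟨N, hN⟩ := hu ε hε
    refine ⟨N, fun i hi j hj => lt_of_le_of_lt ?_ (hN i hi j hj)⟩
    rw [dist_eq_norm, dist_eq_norm, ← hsub]
    exact norm_le_schattenNorm hp.out (u i - u j).memSchatten
  obtain ⟨T, hT⟩ := cauchySeq_tendsto_of_complete hop
  have hp1 : 1 ≤ p := hp.out
  have key : ∀ ε > 0, ∃ N, ∀ i ≥ N, MemSchatten p ((u i).toCLM - T) ∧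
      schattenNorm p ((u i).toCLM - T) ≤ ε := by
    intro ε hε
    obtain ⟨N, hN⟩ := hu ε hε
    refine ⟨N, fun i hi => memSchatten_of_sum_le hp1 fun n => ?_⟩
    have hk : ∀ k, Filter.Tendsto (fun j => approxNumber ((u i).toCLM - (u j).toCLM) k)
        Filter.atTop (nhds (approxNumber ((u i).toCLM - T) k)) := by
      intro k
      rw [tendsto_iff_dist_tendsto_zero]
      refine squeeze_zero (fun _ => dist_nonneg) (fun j => ?_)
        (tendsto_iff_dist_tendsto_zero.mp hT)
      have h1 := approxNumber.le_add_norm ((u i).toCLM - (u j).toCLM) ((u i).toCLM - T) k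
      have h2 := approxNumber.le_add_norm ((u i).toCLM - T) ((u i).toCLM - (u j).toCLM) k
      rw [sub_sub_sub_cancel_left] at h1 h2
      rw [norm_sub_rev] at h1
      rw [Real.dist_eq, dist_eq_norm, abs_le]
      constructor <;> linarith
    have hsum : Filter.Tendsto (fun j => (∑ k ∈ Finset.range n,
        approxNumber ((u i).toCLM - (u j).toCLM) k ^ p) ^ (1 / p)) Filter.atTop
        (nhds ((∑ k ∈ Finset.range n, approxNumber ((u i).toCLM - T) k ^ p) ^ (1 / p))) :=
      (tendsto_finsetSum _ fun k _ => (hk k).rpow_const (Or.inr (by linarith))).rpow_const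
        (Or.inr (by positivity))
    refine le_of_tendsto hsum (Filter.eventually_atTop.mpr ⟨N, fun j hj => ?_⟩)
    have h1 := hN i hi j hj
    rw [dist_eq_norm] at h1
    exact (sum_le_schattenNorm hp1 (u i - u j).memSchatten _).trans h1.le
  have hTm : MemSchatten p T := by
    obtain ⟨N, hN⟩ := key 1 one_pos
    have h := MemSchatten.add hp1 (u N).memSchatten ((hN N le_rfl).1.smul (-1))
    simpa using h
  refine ⟨ofMem T hTm, ?_⟩
  rw [Metric.tendsto_atTop]
  intro ε hε
  obtain ⟨N, hN⟩ := key (ε / 2) (half_pos hε)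
  refine ⟨N, fun i hi => ?_⟩
  rw [dist_eq_norm]
  exact lt_of_le_of_lt (hN i hi).2 (half_lt_self hε)

end SchattenClass

end Schatten

/-! ### Approximate amenability -/

/-- A Banach `A`-bimodule structure on the Banach space `X`: a left action `left a x = a · x` and a
right action `right a x = x · a`, both bilinear and jointly continuous, which commute. -/
structure BanachBimodule (A X : Type*) [NonUnitalNormedRing A] [NormedSpace ℂ A]
    [NormedAddCommGroup X] [NormedSpace ℂ X] where
  left : A →L[ℂ] X →L[ℂ] X
  right : A →L[ℂ] X →L[ℂ] X
  left_mul : ∀ a b x, left (a * b) x = left a (left b x)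
  right_mul : ∀ a b x, right (a * b) x = right b (right a x)
  left_right : ∀ a b x, left a (right b x) = right b (left a x)

namespace BanachBimodule

variable {A X : Type*} [NonUnitalNormedRing A] [NormedSpace ℂ A]
  [NormedAddCommGroup X] [NormedSpace ℂ X]

/-- The dual bimodule `X*`, where `(a · f)(x) = f(x · a)` and `(f · a)(x) = f(a · x)`. -/
noncomputable def dual (M : BanachBimodule A X) : BanachBimodule A (StrongDual ℂ X) where
  left := (ContinuousLinearMap.compL ℂ X X ℂ).flip ∘L M.right
  right := (ContinuousLinearMap.compL ℂ X X ℂ).flip ∘L M.left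
  left_mul a b f := by ext x; simp [M.right_mul]
  right_mul a b f := by ext x; simp [M.left_mul]
  left_right a b f := by ext x; simp [M.left_right]

/-- `D` is a derivation: `D(ab) = a · D(b) + D(a) · b`. Linearity and continuity are part of its
type. -/
def IsDerivation (M : BanachBimodule A X) (D : A →L[ℂ] X) : Prop :=
  ∀ a b, D (a * b) = M.left a (D b) + M.right b (D a)

end BanachBimodule

/-- `D` is approximately inner: there is a net `(x i)` in `X` such that the inner derivations
`a ↦ a · x i - x i · a` converge to `D` in the strong operator topology. (Such a net can always be
reindexed by pairs of a finite subset of `A` and a natural number, so index sets from the universe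
of `A` suffice.) -/
def BanachBimodule.IsApproximatelyInner {A : Type u} {X : Type*} [NonUnitalNormedRing A]
    [NormedSpace ℂ A] [NormedAddCommGroup X] [NormedSpace ℂ X] (M : BanachBimodule A X)
    (D : A →L[ℂ] X) : Prop :=
  ∃ (ι : Type u) (_ : Preorder ι) (_ : IsDirectedOrder ι) (_ : Nonempty ι) (x : ι → X),
    ∀ a, Filter.Tendsto (fun i => M.left a (x i) - M.right a (x i)) Filter.atTop (nhds (D a))

/-- The Banach algebra `A` is approximately amenable: for every Banach `A`-bimodule `X`, every
continuous derivation from `A` into the dual bimodule `X*` is approximately inner. -/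
def ApproximatelyAmenable (A : Type u) [NonUnitalNormedRing A] [NormedSpace ℂ A]
    [IsScalarTower ℂ A A] [SMulCommClass ℂ A A] [CompleteSpace A] : Prop :=
  ∀ (X : Type u) [NormedAddCommGroup X] [NormedSpace ℂ X] [CompleteSpace X]
    (M : BanachBimodule A X) (D : A →L[ℂ] StrongDual ℂ X),
    M.dual.IsDerivation D → M.dual.IsApproximatelyInner D

/-! Write 1 for the unit adjoined to the algebra A, and let K = A⊗A + A⊗1 + 1⊗A, a sub-bimodule of
the unitization tensored with itself that omits 1⊗1. A punctured bilinear form is a functional on K.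
The map a ↦ a⊗1 - 1⊗a is formally the commutator with 1⊗1, so it is a derivation into K**, but 1⊗1
is not available to make it inner. Approximate amenability supplies functionals Ψ with a·Ψ - Ψ·a
close to a⊗1 - 1⊗a for finitely many prescribed a.

Two elements suffice for a contradiction. Take mutually orthogonal blocks d_{n,s} (s one of two
colours) of norm at most N_n, with dual functionals f_{n,s} of norm at most 1/N_n, and put a_s = ∑
2^{-n} N_n^{-1} d_{n,s}. Then f_{n,s} is an eigenfunctional of a_s on both sides and kills the other
colour. Below, 1 as a tensor factor of a form is the functional that is 1 at the unit and 0 on A.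

Testing the approximate identity for both a_s on f_{n,false}⊗f_{m,true} shows that F_n =
Ψ(f_{n,false}⊗1) and G_m = Ψ(1⊗f_{m,true}) differ by a small multiple of 2^n/N_m + 2^m/N_n
(`norm_sub_le_of_eigenfunctionals`). As N_n ≥ 4^n, going from F_n to F_{n+1} through G_n costs
O(2^{-n}), so all F_n stay within 1/2 of F_0. But F_n tends to 0, because f_{n,false} does and Ψ is
bounded, while testing on f_{0,false}⊗1 gives F_0 ≈ 1 (`norm_sub_one_le_of_eigenfunctional`). The
norm of Ψ never enters quantitatively.

In the Schatten class, the blocks are projections of rank r_n along an orthonormal family and the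
functionals are normalized traces over the blocks. Both bounds hold with N_n = r_n^{1/p}, the second
by pinching and Hölder. Since p < ∞, letting r_n grow geometrically makes N_n ≥ 4^n. -/

section Criterion

/-! ### Punctured bilinear forms and their bimodule structure. -/

variable {A : Type u} [NonUnitalNormedRing A] [NormedSpace ℂ A]

variable (A) in
/-- Functions `(b, c) ↦ x (b, c)` on two copies of the unitization of `A` that are bilinear,
bounded and vanish at `(1, 1)`, recorded as the triple of `x (b, c)`, `x (b, 1)` and `x (1, c)`. -/
def PuncturedBilin : Type u := (A →L[ℂ] A →L[ℂ] ℂ) × (A →L[ℂ] ℂ) × (A →L[ℂ] ℂ)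

namespace PuncturedBilin

open ContinuousLinearMap

noncomputable instance : NormedAddCommGroup (PuncturedBilin A) :=
  inferInstanceAs (NormedAddCommGroup ((A →L[ℂ] A →L[ℂ] ℂ) × (A →L[ℂ] ℂ) × (A →L[ℂ] ℂ)))

noncomputable instance : NormedSpace ℂ (PuncturedBilin A) :=
  inferInstanceAs (NormedSpace ℂ ((A →L[ℂ] A →L[ℂ] ℂ) × (A →L[ℂ] ℂ) × (A →L[ℂ] ℂ)))

instance : CompleteSpace (PuncturedBilin A) :=
  inferInstanceAs (CompleteSpace ((A →L[ℂ] A →L[ℂ] ℂ) × (A →L[ℂ] ℂ) × (A →L[ℂ] ℂ)))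

/-- The punctured bilinear form with the given components. -/
def mk (φ : A →L[ℂ] A →L[ℂ] ℂ) (f g : A →L[ℂ] ℂ) : PuncturedBilin A := (φ, f, g)

variable (A) in
/-- The restriction of `x` to `A × A`. -/
noncomputable def form : PuncturedBilin A →L[ℂ] A →L[ℂ] A →L[ℂ] ℂ :=
  fst ℂ (A →L[ℂ] A →L[ℂ] ℂ) ((A →L[ℂ] ℂ) × (A →L[ℂ] ℂ))

variable (A) in
/-- The functional `b ↦ x (b, 1)`. -/
noncomputable def atOneRight : PuncturedBilin A →L[ℂ] A →L[ℂ] ℂ :=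
  fst ℂ (A →L[ℂ] ℂ) (A →L[ℂ] ℂ) ∘L snd ℂ (A →L[ℂ] A →L[ℂ] ℂ) ((A →L[ℂ] ℂ) × (A →L[ℂ] ℂ))

variable (A) in
/-- The functional `c ↦ x (1, c)`. -/
noncomputable def atOneLeft : PuncturedBilin A →L[ℂ] A →L[ℂ] ℂ :=
  snd ℂ (A →L[ℂ] ℂ) (A →L[ℂ] ℂ) ∘L snd ℂ (A →L[ℂ] A →L[ℂ] ℂ) ((A →L[ℂ] ℂ) × (A →L[ℂ] ℂ))

@[simp] lemma form_mk (φ : A →L[ℂ] A →L[ℂ] ℂ) (f g : A →L[ℂ] ℂ) : form A (mk φ f g) = φ := rfl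

@[simp] lemma atOneRight_mk (φ : A →L[ℂ] A →L[ℂ] ℂ) (f g : A →L[ℂ] ℂ) :
    atOneRight A (mk φ f g) = f := rfl

@[simp] lemma atOneLeft_mk (φ : A →L[ℂ] A →L[ℂ] ℂ) (f g : A →L[ℂ] ℂ) :
    atOneLeft A (mk φ f g) = g := rfl

@[ext] lemma ext {x y : PuncturedBilin A} (h₁ : ∀ b c, form A x b c = form A y b c)
    (h₂ : ∀ b, atOneRight A x b = atOneRight A y b) (h₃ : ∀ c, atOneLeft A x c = atOneLeft A y c) :
    x = y :=
  Prod.ext (ContinuousLinearMap.ext fun b => ContinuousLinearMap.ext (h₁ b))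
    (Prod.ext (ContinuousLinearMap.ext h₂) (ContinuousLinearMap.ext h₃))

lemma norm_form_le (x : PuncturedBilin A) : ‖form A x‖ ≤ ‖x‖ := _root_.norm_fst_le x

lemma norm_atOneRight_le (x : PuncturedBilin A) : ‖atOneRight A x‖ ≤ ‖x‖ :=
  (_root_.norm_fst_le x.2).trans (_root_.norm_snd_le x)

lemma norm_atOneLeft_le (x : PuncturedBilin A) : ‖atOneLeft A x‖ ≤ ‖x‖ :=
  (_root_.norm_snd_le x.2).trans (_root_.norm_snd_le x)

lemma norm_mk_le {φ : A →L[ℂ] A →L[ℂ] ℂ} {f g : A →L[ℂ] ℂ} {C : ℝ} (h₁ : ‖φ‖ ≤ C) (h₂ : ‖f‖ ≤ C)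
    (h₃ : ‖g‖ ≤ C) : ‖mk φ f g‖ ≤ C :=
  norm_prod_le_iff.mpr ⟨h₁, norm_prod_le_iff.mpr ⟨h₂, h₃⟩⟩

/-- The form here is φ⊗ψ, with φ and ψ extended by 0 to the unit; it is the main test form. -/
lemma norm_tensor_le (φ ψ : A →L[ℂ] ℂ) : ‖mk (φ.smulRight ψ) 0 0‖ ≤ ‖φ‖ * ‖ψ‖ := by
  have h : 0 ≤ ‖φ‖ * ‖ψ‖ := by positivity
  exact norm_mk_le (norm_smulRight_apply _ _).le (norm_zero.trans_le h) (norm_zero.trans_le h)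

lemma norm_mk_zero_zero_le (φ : A →L[ℂ] ℂ) : ‖mk 0 φ 0‖ ≤ ‖φ‖ :=
  norm_mk_le (opNorm_zero.trans_le (norm_nonneg φ)) le_rfl (opNorm_zero.trans_le (norm_nonneg φ))

variable (A) in
/-- The derivation `a ↦ a ⊗ 1 - 1 ⊗ a`, as a functional on punctured bilinear forms. -/
noncomputable def derivation : A →L[ℂ] StrongDual ℂ (PuncturedBilin A) :=
  (atOneRight A - atOneLeft A).flip

lemma derivation_apply (a : A) (x : PuncturedBilin A) :
    derivation A a x = atOneRight A x a - atOneLeft A x a := rfl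

variable [IsScalarTower ℂ A A] [SMulCommClass ℂ A A]

/-- The left action `(a · x) (b, c) = x (b, c a)`. -/
noncomputable def leftAction (a : A) (x : PuncturedBilin A) : PuncturedBilin A :=
  -- The formula would give the value x(1, a) at (1, 1), which is discarded. This is consistent
  -- because a form is only a functional on A⊗A + A⊗1 + 1⊗A, a space stable under both
  -- multiplications.
  mk ((compL ℂ A A ℂ).flip ((mul ℂ A).flip a) ∘L form A x) ((form A x).flip a)
    (atOneLeft A x ∘L (mul ℂ A).flip a)

/-- The right action `(x · a) (b, c) = x (a b, c)`. -/
noncomputable def rightAction (a : A) (x : PuncturedBilin A) : PuncturedBilin A :=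
  mk (form A x ∘L mul ℂ A a) (atOneRight A x ∘L mul ℂ A a) (form A x a)

lemma norm_leftAction_le (a : A) (x : PuncturedBilin A) : ‖leftAction a x‖ ≤ ‖x‖ * ‖a‖ := by
  have h1 := norm_form_le x
  have h2 := norm_atOneLeft_le x
  refine norm_mk_le ?_ ?_ ?_
  · refine opNorm_le_bound₂ _ (by positivity) fun b c => ?_
    calc ‖form A x b (c * a)‖ ≤ ‖form A x‖ * ‖b‖ * ‖c * a‖ := le_opNorm₂ _ _ _
      _ ≤ ‖x‖ * ‖b‖ * (‖c‖ * ‖a‖) := by gcongr; exact norm_mul_le c a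
      _ = _ := by ring
  · refine opNorm_le_bound _ (by positivity) fun b => ?_
    calc ‖form A x b a‖ ≤ ‖form A x‖ * ‖b‖ * ‖a‖ := le_opNorm₂ _ _ _
      _ ≤ ‖x‖ * ‖b‖ * ‖a‖ := by gcongr
      _ = _ := by ring
  · refine opNorm_le_bound _ (by positivity) fun c => ?_
    calc ‖atOneLeft A x (c * a)‖ ≤ ‖atOneLeft A x‖ * ‖c * a‖ := le_opNorm _ _
      _ ≤ ‖x‖ * (‖c‖ * ‖a‖) := by gcongr; exact norm_mul_le c a
      _ = _ := by ring

lemma norm_rightAction_le (a : A) (x : PuncturedBilin A) : ‖rightAction a x‖ ≤ ‖x‖ * ‖a‖ := by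
  have h1 := norm_form_le x
  have h2 := norm_atOneRight_le x
  refine norm_mk_le ?_ ?_ ?_
  · refine opNorm_le_bound₂ _ (by positivity) fun b c => ?_
    calc ‖form A x (a * b) c‖ ≤ ‖form A x‖ * ‖a * b‖ * ‖c‖ := le_opNorm₂ _ _ _
      _ ≤ ‖x‖ * (‖a‖ * ‖b‖) * ‖c‖ := by gcongr; exact norm_mul_le a b
      _ = _ := by ring
  · refine opNorm_le_bound _ (by positivity) fun b => ?_
    calc ‖atOneRight A x (a * b)‖ ≤ ‖atOneRight A x‖ * ‖a * b‖ := le_opNorm _ _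
      _ ≤ ‖x‖ * (‖a‖ * ‖b‖) := by gcongr; exact norm_mul_le a b
      _ = _ := by ring
  · exact (le_opNorm (form A x) a).trans (by gcongr)

variable (A) in
/-- The left action of `A` as a continuous bilinear map. -/
noncomputable def left : A →L[ℂ] PuncturedBilin A →L[ℂ] PuncturedBilin A :=
  LinearMap.mkContinuous₂ (LinearMap.mk₂ ℂ leftAction
    (fun a a' x => by ext <;> simp [leftAction]) (fun c a x => by ext <;> simp [leftAction])
    (fun a x x' => by ext <;> simp [leftAction]) (fun c a x => by ext <;> simp [leftAction])) 1
    fun a x => (norm_leftAction_le a x).trans_eq (by ring)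

variable (A) in
/-- The right action of `A` as a continuous bilinear map. -/
noncomputable def right : A →L[ℂ] PuncturedBilin A →L[ℂ] PuncturedBilin A :=
  LinearMap.mkContinuous₂ (LinearMap.mk₂ ℂ rightAction
    (fun a a' x => by ext <;> simp [rightAction]) (fun c a x => by ext <;> simp [rightAction])
    (fun a x x' => by ext <;> simp [rightAction]) (fun c a x => by ext <;> simp [rightAction])) 1
    fun a x => (norm_rightAction_le a x).trans_eq (by ring)

@[simp] lemma left_apply (a : A) (x : PuncturedBilin A) : left A a x =
    mk ((compL ℂ A A ℂ).flip ((mul ℂ A).flip a) ∘L form A x)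
      ((form A x).flip a) (atOneLeft A x ∘L (mul ℂ A).flip a) := rfl

@[simp] lemma right_apply (a : A) (x : PuncturedBilin A) :
    right A a x = mk (form A x ∘L mul ℂ A a) (atOneRight A x ∘L mul ℂ A a) (form A x a) := rfl

variable (A) in
/-- The punctured bilinear forms as a Banach `A`-bimodule. -/
noncomputable def bimodule : BanachBimodule A (PuncturedBilin A) where
  left := left A
  right := right A
  left_mul a b x := by ext <;> simp [mul_assoc]
  right_mul a b x := by ext <;> simp [mul_assoc]
  left_right a b x := by ext <;> simp

/-- In ab⊗1 - 1⊗ab = a·(b⊗1 - 1⊗b) + (a⊗1 - 1⊗a)·b the two mixed terms a⊗b cancel. -/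
lemma isDerivation : (bimodule A).dual.IsDerivation (derivation A) := by
  intro a b
  ext x
  have h1 : (bimodule A).dual.left a (derivation A b) x = derivation A b (right A a x) := rfl
  have h2 : (bimodule A).dual.right b (derivation A a) x = derivation A a (left A b x) := rfl
  rw [_root_.add_apply, h1, h2]
  simp [derivation_apply]

/-! ### Testing almost inner derivations on eigenfunctionals. -/

/-- If the inner derivation of `Ψ` is close to `derivation A` at `a` and at `b`, where `φ` is an
eigenfunctional of `a` that kills `b` and `ψ` is an eigenfunctional of `b` that kills `a`, then
`Ψ (φ ⊗ 1)` and `Ψ (1 ⊗ ψ)` are close to each other. -/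
lemma norm_sub_le_of_eigenfunctionals {Ψ : StrongDual ℂ (PuncturedBilin A)} {a b : A} {ε : ℝ}
    (ha : ‖(bimodule A).dual.left a Ψ - (bimodule A).dual.right a Ψ - derivation A a‖ ≤ ε)
    (hb : ‖(bimodule A).dual.left b Ψ - (bimodule A).dual.right b Ψ - derivation A b‖ ≤ ε)
    {φ ψ : A →L[ℂ] ℂ} {x y : ℝ} (hx : 0 < x) (hy : 0 < y)
    (hφa : ∀ c, φ (a * c) = x * φ c) (hφa' : φ a = x) (hφb : ∀ c, φ (b * c) = 0) (hφb' : φ b = 0)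
    (hψb : ∀ c, ψ (c * b) = y * ψ c) (hψb' : ψ b = y) (hψa : ∀ c, ψ (c * a) = 0) (hψa' : ψ a = 0) :
    ‖Ψ (mk 0 φ 0) - Ψ (mk 0 0 ψ)‖ ≤ ε * (‖φ‖ * ‖ψ‖) * (x⁻¹ + y⁻¹) := by
  have hε : 0 ≤ ε := (norm_nonneg _).trans ha
  -- The derivation vanishes on φ⊗ψ, which has no unit components, so Ψ itself almost annihilates
  -- the commutator of c with φ⊗ψ.
  have key : ∀ c, ‖(bimodule A).dual.left c Ψ - (bimodule A).dual.right c Ψ - derivation A c‖ ≤ ε →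
      ‖Ψ (right A c (mk (φ.smulRight ψ) 0 0) - left A c (mk (φ.smulRight ψ) 0 0))‖ ≤ ε * (‖φ‖ * ‖ψ‖) := by
    intro c hc
    have h := (le_opNorm _ (mk (φ.smulRight ψ) 0 0)).trans
      (mul_le_mul hc (norm_tensor_le φ ψ) (norm_nonneg _) hε)
    refine le_trans (le_of_eq ?_) h
    have h1 : derivation A c (mk (φ.smulRight ψ) 0 0) = 0 := by simp [derivation_apply]
    rw [_root_.sub_apply, h1, sub_zero, map_sub]
    rfl
  -- The extra term 1⊗ψ is the value φ(a)ψ(c) at (1, c). For b the roles swap and φ⊗1 appears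
  -- instead; subtracting the two estimates eliminates the common term Ψ(φ⊗ψ).
  have ha' : right A a (mk (φ.smulRight ψ) 0 0) - left A a (mk (φ.smulRight ψ) 0 0) =
      (x : ℂ) • (mk (φ.smulRight ψ) 0 0 + (mk 0 0 ψ)) := by
    ext <;> simp [hφa, hφa', hψa, hψa', mul_assoc]
  have hb' : right A b (mk (φ.smulRight ψ) 0 0) - left A b (mk (φ.smulRight ψ) 0 0) =
      -((y : ℂ) • (mk (φ.smulRight ψ) 0 0 + (mk 0 φ 0))) := by
    ext <;> simp [hφb, hφb', hψb, hψb', mul_left_comm, mul_comm]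
  have h1 := key a ha
  have h2 := key b hb
  rw [ha', map_smul, norm_smul, Complex.norm_real, Real.norm_of_nonneg hx.le,
    ← le_div_iff₀' hx, div_eq_mul_inv, map_add] at h1
  rw [hb', map_neg, norm_neg, map_smul, norm_smul, Complex.norm_real, Real.norm_of_nonneg hy.le,
    ← le_div_iff₀' hy, div_eq_mul_inv, map_add] at h2
  have h3 : Ψ (mk 0 φ 0) - Ψ (mk 0 0 ψ) =
      (Ψ (mk (φ.smulRight ψ) 0 0) + Ψ (mk 0 φ 0)) - (Ψ (mk (φ.smulRight ψ) 0 0) + Ψ (mk 0 0 ψ)) := by ring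
  rw [h3, mul_add]
  exact (norm_sub_le _ _).trans (by linarith)

/-- If the inner derivation of `Ψ` is close to `derivation A` at `a` and `φ` is an eigenfunctional
of `a`, then `Ψ (φ ⊗ 1)` is close to `1`. -/
lemma norm_sub_one_le_of_eigenfunctional {Ψ : StrongDual ℂ (PuncturedBilin A)} {a : A} {ε : ℝ}
    (ha : ‖(bimodule A).dual.left a Ψ - (bimodule A).dual.right a Ψ - derivation A a‖ ≤ ε)
    {φ : A →L[ℂ] ℂ} {x : ℝ} (hx : 0 < x) (hφa : ∀ c, φ (a * c) = x * φ c) (hφa' : φ a = x) :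
    ‖Ψ (mk 0 φ 0) - 1‖ ≤ ε * ‖φ‖ * x⁻¹ := by
  have h0 := norm_mk_zero_zero_le φ
  have h := (le_opNorm _ (mk 0 φ 0 : PuncturedBilin A)).trans
    (mul_le_mul ha h0 (norm_nonneg _) ((norm_nonneg _).trans ha))
  -- The left action kills φ⊗1, since this form vanishes on A × A and at (1, c). Here the derivation
  -- does not vanish: its value φ(a) = x produces the 1 in the conclusion.
  have h1 : right A a (mk 0 φ 0) - left A a (mk 0 φ 0) = (x : ℂ) • (mk 0 φ 0) := by
    ext <;> simp [hφa]
  have h2 : ((bimodule A).dual.left a Ψ - (bimodule A).dual.right a Ψ - derivation A a)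
      (mk 0 φ 0) = x * (Ψ (mk 0 φ 0) - 1) := by
    have h3 : ((bimodule A).dual.left a Ψ - (bimodule A).dual.right a Ψ) (mk 0 φ 0) =
      Ψ (right A a (mk 0 φ 0) - left A a (mk 0 φ 0)) := by rw [map_sub]; rfl
    rw [_root_.sub_apply, h3, h1, derivation_apply, map_smul]
    simp [hφa', mul_sub]
  rw [h2, norm_mul, Complex.norm_real, Real.norm_of_nonneg hx.le] at h
  rwa [← div_eq_mul_inv, le_div_iff₀' hx]

end PuncturedBilin

/-! ### The block criterion. -/

section Blocks

variable [IsScalarTower ℂ A A] [SMulCommClass ℂ A A] [CompleteSpace A]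

/-- A Banach algebra with two sequences of "block units" `d n s` of norm at most `N n`, where
`N n ≥ 4 ^ n`, and functionals `f n s` of norm at most `(N n)⁻¹` that are biorthogonal to them even
as `A`-module maps, is not approximately amenable. -/
theorem not_approximatelyAmenable_of_blocks (d : ℕ → Bool → A) (f : ℕ → Bool → A →L[ℂ] ℂ)
    (N : ℕ → ℝ) (hN : ∀ n, 4 ^ n ≤ N n) (hmono : Monotone N)
    (hd : ∀ n s, ‖d n s‖ ≤ N n) (hf : ∀ n s, ‖f n s‖ ≤ (N n)⁻¹)
    (hleft : ∀ n s m t c, f n s (d m t * c) = if n = m ∧ s = t then f n s c else 0)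
    (hright : ∀ n s m t c, f n s (c * d m t) = if n = m ∧ s = t then f n s c else 0)
    (hself : ∀ n s m t, f n s (d m t) = if n = m ∧ s = t then 1 else 0) :
    ¬ ApproximatelyAmenable A := by
  intro hA
  obtain ⟨ι, _, _, _, Ψ, hΨ⟩ := hA (PuncturedBilin A) (PuncturedBilin.bimodule A)
    (PuncturedBilin.derivation A) PuncturedBilin.isDerivation
  have hN0 : ∀ n, 0 < N n := fun n => lt_of_lt_of_le (by positivity) (hN n)
  -- The weights make ∑ x_n d_{n,s} absolutely convergent, and their inverses 2^n N_n exceed N_n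
  -- only by the factor 2^n, which 4^n ≤ N_n can absorb.
  set x : ℕ → ℝ := fun n => (1 / 2) ^ n * (N n)⁻¹ with hx
  have hx0 : ∀ n, 0 < x n := fun n => mul_pos (by positivity) (inv_pos.mpr (hN0 n))
  have hsum : ∀ s, Summable fun n => (x n : ℂ) • d n s := by
    intro s
    refine Summable.of_norm_bounded (summable_geometric_two) fun n => ?_
    rw [norm_smul, Complex.norm_real, Real.norm_of_nonneg (hx0 n).le, hx]
    calc (1 / 2 : ℝ) ^ n * (N n)⁻¹ * ‖d n s‖ ≤ (1 / 2) ^ n * (N n)⁻¹ * N n :=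
        mul_le_mul_of_nonneg_left (hd n s) (hx0 n).le
      _ = (1 / 2) ^ n := by rw [mul_assoc, inv_mul_cancel₀ (hN0 n).ne', mul_one]
  set a : Bool → A := fun s => ∑' n, (x n : ℂ) • d n s with ha
  -- Stated for general g so that it applies to f_{n,s} alone and composed with left or right
  -- multiplication by c.
  have hfa : ∀ (g : A →L[ℂ] ℂ) (n : ℕ) (v : ℂ) (s t : Bool),
      (∀ m, g (d m t) = if n = m ∧ s = t then v else 0) → g (a t) = if s = t then x n * v else 0 := by
    intro g n v s t hg
    rw [ha, g.map_tsum (hsum t), tsum_eq_single n]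
    · simp [hg]
    · intro m hm
      simp [hg, hm.symm]
  have h1 : ∀ n s t, f n s (a t) = if s = t then (x n : ℂ) else 0 := fun n s t => by
    simpa using hfa (f n s) n 1 s t fun m => hself n s m t
  have h2 : ∀ n s t c, f n s (a t * c) = if s = t then x n * f n s c else 0 := fun n s t c =>
    hfa (f n s ∘L (ContinuousLinearMap.mul ℂ A).flip c) n (f n s c) s t fun m => hleft n s m t c
  have h3 : ∀ n s t c, f n s (c * a t) = if s = t then x n * f n s c else 0 := fun n s t c =>
    hfa (f n s ∘L ContinuousLinearMap.mul ℂ A c) n (f n s c) s t fun m => hright n s m t c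
  have hev : ∀ s, ∀ᶠ i in Filter.atTop, ‖(PuncturedBilin.bimodule A).dual.left (a s) (Ψ i) -
      (PuncturedBilin.bimodule A).dual.right (a s) (Ψ i) - PuncturedBilin.derivation A (a s)‖
        ≤ 1 / 20 := by
    intro s
    filter_upwards [(Metric.tendsto_nhds.mp (hΨ (a s))) (1 / 20) (by norm_num)] with i hi
    rw [← dist_eq_norm]
    exact hi.le
  -- One index serves both elements; from here on Ψ i is a single fixed bounded functional.
  obtain ⟨i, hi0, hi1⟩ := ((hev false).and (hev true)).exists
  set F : ℕ → ℂ := fun n => Ψ i (.mk 0 (f n false) 0)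
  set G : ℕ → ℂ := fun n => Ψ i (.mk 0 0 (f n true))
  have hFG : ∀ n m, ‖F n - G m‖ ≤ 1 / 20 * ((N n)⁻¹ * (N m)⁻¹) * ((x n)⁻¹ + (x m)⁻¹) := by
    intro n m
    have := PuncturedBilin.norm_sub_le_of_eigenfunctionals hi0 hi1 (hx0 n) (hx0 m)
      (φ := f n false) (ψ := f m true) (fun c => by simp [h2]) (by simp [h1])
      (fun c => by simp [h2]) (by simp [h1]) (fun c => by simp [h3]) (by simp [h1])
      (fun c => by simp [h3]) (by simp [h1])
    refine this.trans ?_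
    have := hx0 n
    have := hx0 m
    have := hN0 n
    gcongr
    · exact hf n false
    · exact hf m true
  have hxinv : ∀ n, (x n)⁻¹ = 2 ^ n * N n := fun n => by simp [hx, mul_comm]
  have hsmall : ∀ n, 2 ^ n * (N n)⁻¹ ≤ (1 / 2) ^ n := by
    intro n
    rw [← div_eq_mul_inv, div_le_iff₀ (hN0 n)]
    calc (2 : ℝ) ^ n = (1 / 2) ^ n * 4 ^ n := by rw [← mul_pow]; norm_num
      _ ≤ _ := by gcongr; exact hN n
  -- Pass through G_n. With tolerance 1/20, the first leg costs 1/10 and the second 1/10 + 1/20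
  -- times 2^n/N_n ≤ 2^{-n}; the total 1/4 makes the telescoping sum at most 1/2.
  have hstep : ∀ n, ‖F n - F (n + 1)‖ ≤ 1 / 4 * (1 / 2) ^ n := by
    intro n
    have e1 := hFG n n
    have e2 := hFG (n + 1) n
    have hle : (N (n + 1))⁻¹ ≤ (N n)⁻¹ := inv_anti₀ (hN0 n) (hmono n.le_succ)
    have hs := hsmall n
    rw [hxinv, show 1 / 20 * ((N n)⁻¹ * (N n)⁻¹) * (2 ^ n * N n + 2 ^ n * N n) =
      1 / 10 * (2 ^ n * (N n)⁻¹) * (N n * (N n)⁻¹) by ring, mul_inv_cancel₀ (hN0 n).ne'] at e1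
    rw [hxinv, hxinv, show 1 / 20 * ((N (n + 1))⁻¹ * (N n)⁻¹) *
      (2 ^ (n + 1) * N (n + 1) + 2 ^ n * N n) =
      1 / 10 * (2 ^ n * (N n)⁻¹) * (N (n + 1) * (N (n + 1))⁻¹) +
        1 / 20 * (2 ^ n * (N (n + 1))⁻¹) * (N n * (N n)⁻¹) by ring,
      mul_inv_cancel₀ (hN0 n).ne', mul_inv_cancel₀ (hN0 (n + 1)).ne'] at e2
    have hle' : 2 ^ n * (N (n + 1))⁻¹ ≤ 2 ^ n * (N n)⁻¹ :=
      mul_le_mul_of_nonneg_left hle (by positivity)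
    have h3 : F n - F (n + 1) = (F n - G n) - (F (n + 1) - G n) := by ring
    rw [h3]
    exact (norm_sub_le _ _).trans (by linarith)
  have hF0 : ∀ n, ‖F 0 - F n‖ ≤ 1 / 2 := by
    intro n
    -- The exact partial sum of the geometric series, so that the induction closes.
    have : ‖F 0 - F n‖ ≤ 1 / 2 - 1 / 2 * (1 / 2) ^ n := by
      induction n with
      | zero => simp
      | succ n ih =>
        have h3 : F 0 - F (n + 1) = (F 0 - F n) + (F n - F (n + 1)) := by ring
        have := hstep n
        rw [h3, pow_succ]
        exact (norm_add_le _ _).trans (by linarith)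
    have h0 : (0 : ℝ) ≤ 1 / 2 * (1 / 2) ^ n := by positivity
    linarith
  have hFb : ∀ n, ‖F n‖ ≤ ‖Ψ i‖ * (1 / 4) ^ n := by
    intro n
    refine ((Ψ i).le_opNorm _).trans (mul_le_mul_of_nonneg_left ?_ (norm_nonneg _))
    refine (PuncturedBilin.norm_mk_zero_zero_le _).trans ((hf n false).trans ?_)
    rw [one_div, inv_pow]
    exact inv_anti₀ (by positivity) (hN n)
  have hlim : Filter.Tendsto F Filter.atTop (nhds 0) := by
    refine squeeze_zero_norm hFb ?_
    simpa using (tendsto_pow_atTop_nhds_zero_of_lt_one (r := (1 / 4 : ℝ)) (by norm_num)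
      (by norm_num)).const_mul ‖Ψ i‖
  have hF0' : ‖F 0‖ ≤ 1 / 2 := by
    have := (tendsto_const_nhds.sub hlim : Filter.Tendsto (fun n => F 0 - F n) _ _).norm
    rw [sub_zero] at this
    exact le_of_tendsto' this hF0
  -- At n = 0 the factors ‖f_{0,false}‖ ≤ 1/N_0 and 1/x_0 = N_0 cancel. This contradicts ‖F 0‖ ≤
  -- 1/2.
  have hF1 : ‖F 0 - 1‖ ≤ 1 / 20 := by
    have := PuncturedBilin.norm_sub_one_le_of_eigenfunctional hi0 (hx0 0)
      (φ := f 0 false) (fun c => by simp [h2]) (by simp [h1])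
    refine this.trans ?_
    rw [hxinv, mul_assoc, pow_zero, one_mul]
    have := mul_le_mul_of_nonneg_right (hf 0 false) (hN0 0).le
    rw [inv_mul_cancel₀ (hN0 0).ne'] at this
    linarith
  have := norm_sub_norm_le (1 : ℂ) (F 0)
  rw [norm_one, norm_sub_rev] at this
  linarith

end Blocks

end Criterion

/-! ### Block projections and diagonal sums along an orthonormal family. -/

section OrthonormalBlocks

variable {H : Type u} [NormedAddCommGroup H] [InnerProductSpace ℂ H]

theorem exists_orthonormal_of_not_finiteDimensional (hH : ¬ FiniteDimensional ℂ H) (ι : Type*)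
    [Countable ι] : ∃ e : ι → H, Orthonormal ℂ e := by
  let b := Module.Basis.ofVectorSpace ℂ H
  have : Infinite (Module.Basis.ofVectorSpaceIndex ℂ H) := by
    by_contra h
    rw [not_infinite_iff_finite] at h
    exact hH (Module.Finite.of_basis b)
  obtain ⟨k, hk⟩ := Countable.exists_injective_nat ι
  -- Gram–Schmidt is applied to a sequence from a Hamel basis, then reindexed by an injection of ι
  -- into ℕ.
  refine ⟨InnerProductSpace.gramSchmidtNormed ℂ (b ∘ Infinite.natEmbedding _) ∘ k,
    (InnerProductSpace.gramSchmidtNormed_orthonormal ?_).comp k hk⟩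
  exact b.linearIndependent.comp _ (Infinite.natEmbedding _).injective

variable {ι : Type*} {e : ι → H}

/-- For an orthonormal family `e`, the orthogonal projection onto the span of `e i`, `i ∈ s`. -/
noncomputable def blockProj (e : ι → H) (s : Finset ι) : H →L[ℂ] H :=
  ∑ i ∈ s, (innerSL ℂ (e i)).smulRight (e i)

lemma blockProj_apply (e : ι → H) (s : Finset ι) (x : H) :
    blockProj e s x = ∑ i ∈ s, inner ℂ (e i) x • e i := by
  simp [blockProj]

lemma inner_blockProj [DecidableEq ι] (he : Orthonormal ℂ e) (s : Finset ι) (i : ι) (x : H) :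
    inner ℂ (e i) (blockProj e s x) = if i ∈ s then inner ℂ (e i) x else 0 := by
  simp [blockProj_apply, orthonormal_iff_ite.mp he]

lemma blockProj_apply_self [DecidableEq ι] (he : Orthonormal ℂ e) (s : Finset ι) (i : ι) :
    blockProj e s (e i) = if i ∈ s then e i else 0 := by
  simp [blockProj_apply, orthonormal_iff_ite.mp he]

lemma norm_blockProj_le (he : Orthonormal ℂ e) (s : Finset ι) : ‖blockProj e s‖ ≤ 1 := by
  refine ContinuousLinearMap.opNorm_le_bound _ zero_le_one fun x => ?_
  rw [one_mul, ← sq_le_sq₀ (norm_nonneg _) (norm_nonneg _)]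
  refine le_trans (le_of_eq ?_) (he.sum_inner_products_le (x := x) (s := s))
  have h : ((‖blockProj e s x‖ ^ 2 : ℝ) : ℂ) = ((∑ i ∈ s, ‖inner ℂ (e i) x‖ ^ 2 : ℝ) : ℂ) := by
    have h1 : ((‖blockProj e s x‖ ^ 2 : ℝ) : ℂ) = inner ℂ (blockProj e s x) (blockProj e s x) := by
      rw [inner_self_eq_norm_sq_to_K]; norm_cast
    rw [h1, blockProj_apply, he.inner_sum]
    push_cast
    exact Finset.sum_congr rfl fun i _ => by rw [mul_comm]; exact Complex.mul_conj' _
  exact_mod_cast h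

lemma rank_blockProj_le (e : ι → H) (s : Finset ι) :
    LinearMap.rank (blockProj e s : H →ₗ[ℂ] H) ≤ s.card := by
  classical
  have hle : LinearMap.range (blockProj e s : H →ₗ[ℂ] H) ≤
      Submodule.span ℂ ((s.image e : Finset H) : Set H) := by
    rintro _ ⟨x, rfl⟩
    rw [ContinuousLinearMap.coe_coe, blockProj_apply]
    exact Submodule.sum_mem _ fun i hi => Submodule.smul_mem _ _
      (Submodule.subset_span (Finset.mem_coe.mpr (Finset.mem_image_of_mem _ hi)))
  refine (Submodule.rank_mono hle).trans ((rank_span_finset_le _).trans ?_)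
  exact_mod_cast Finset.card_image_le

variable {p : ℝ}

lemma memSchatten_blockProj (hp : 1 ≤ p) (he : Orthonormal ℂ e) (s : Finset ι) :
    MemSchatten p (blockProj e s) ∧ schattenNorm p (blockProj e s) ≤ (s.card : ℝ) ^ (1 / p) := by
  have hp0 : 0 < p := by linarith
  refine memSchatten_of_sum_le hp fun n => ?_
  refine Real.rpow_le_rpow (Finset.sum_nonneg fun k _ => Real.rpow_nonneg
    (approxNumber.nonneg _ _) p) ?_ (by positivity)
  -- As k counts from 0 and allows rank k, the projection approximates itself once k reaches
  -- `s.card`; at most `s.card` terms survive, each at most 1.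
  have h1 : ∀ k, approxNumber (blockProj e s) k ^ p ≤ if k < s.card then 1 else 0 := by
    intro k
    split_ifs with hk
    · refine Real.rpow_le_one (approxNumber.nonneg _ _) ?_ hp0.le
      refine (approxNumber.le_norm_sub _ 0 k (by simp)).trans ?_
      rw [sub_zero]
      exact norm_blockProj_le he s
    · have h := approxNumber.le_norm_sub (blockProj e s) (blockProj e s) k
        ((rank_blockProj_le e s).trans (by exact_mod_cast not_lt.mp hk))
      rw [sub_self, norm_zero] at h
      rw [le_antisymm h (approxNumber.nonneg _ _), Real.zero_rpow hp0.ne']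
  refine (Finset.sum_le_sum fun k _ => h1 k).trans ?_
  rw [Finset.sum_ite, Finset.sum_const_zero, add_zero, Finset.sum_const, nsmul_eq_mul, mul_one]
  have : (Finset.range n).filter (· < s.card) ⊆ Finset.range s.card := fun k hk =>
    Finset.mem_range.mpr (Finset.mem_filter.mp hk).2
  exact_mod_cast (Finset.card_le_card this).trans_eq (Finset.card_range _)

/-- Pinching: compress T to the span of the chosen vectors. Its diagonal entries are unchanged, its
singular numbers do not increase, and the finite-dimensional inequality `sum_inner_rpow_le` applies.
-/
lemma sum_norm_inner_rpow_le_schattenNorm (hp : 1 ≤ p) (he : Orthonormal ℂ e) (s : Finset ι)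
    {T : H →L[ℂ] H} (hT : MemSchatten p T) :
    (∑ i ∈ s, ‖inner ℂ (e i) (T (e i))‖ ^ p) ^ (1 / p) ≤ schattenNorm p T := by
  classical
  have hp0 : 0 < p := by linarith
  set W := Submodule.span ℂ ((s.image e : Finset H) : Set H)
  have : FiniteDimensional ℂ W := FiniteDimensional.span_finset ℂ _
  have hmem : ∀ i : s, e i ∈ W := fun i =>
    Submodule.subset_span (Finset.mem_coe.mpr (Finset.mem_image_of_mem _ i.2))
  set v : s → W := fun i => ⟨e i, hmem i⟩ with hv
  have hvo : Orthonormal ℂ v := by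
    have h : Orthonormal ℂ fun i : s => e i := he.comp _ Subtype.val_injective
    rw [orthonormal_iff_ite] at h ⊢
    exact h
  have h1 := approxNumber.sum_inner_rpow_le (approxNumber.compress W T) hp hvo hvo
  have h2 : ∀ i : s, inner ℂ (v i) (approxNumber.compress W T (v i)) =
      inner ℂ (e i) (T (e i)) := fun i => by
    simp [approxNumber.compress, hv]
  simp only [h2] at h1
  rw [← Finset.sum_coe_sort]
  refine (Real.rpow_le_rpow (Finset.sum_nonneg fun i _ => by positivity) (h1.trans ?_)
    (by positivity)).trans (sum_le_schattenNorm hp hT (Finset.range (Module.finrank ℂ W)))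
  rw [Finset.sum_range]
  exact Finset.sum_le_sum fun k _ => Real.rpow_le_rpow (approxNumber.nonneg _ _)
    (approxNumber.compress_le W T k) hp0.le

/-- Hölder against the constant 1, after pinching. Dividing by the cardinality leaves exponent -1/p,
exactly inverse to the bound for the block projection. -/
lemma norm_sum_inner_le_schattenNorm (hp : 1 ≤ p) (he : Orthonormal ℂ e) (s : Finset ι)
    {T : H →L[ℂ] H} (hT : MemSchatten p T) :
    ‖∑ i ∈ s, inner ℂ (e i) (T (e i))‖ ≤ (s.card : ℝ) ^ (1 - 1 / p) * schattenNorm p T := by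
  have h1 := Real.inner_le_weight_mul_Lp_of_nonneg s hp (fun _ => 1)
    (fun i => ‖inner ℂ (e i) (T (e i))‖) (fun _ => zero_le_one) (fun _ => norm_nonneg _)
  simp only [one_mul, Finset.sum_const, nsmul_eq_mul, mul_one, ← one_div] at h1
  exact (norm_sum_le _ _).trans (h1.trans (mul_le_mul_of_nonneg_left
    (sum_norm_inner_rpow_le_schattenNorm hp he s hT) (by positivity)))

/-! ### Blocks and normalized traces in the Schatten class. -/

namespace SchattenClass

variable [CompleteSpace H] [hp : Fact (1 ≤ p)]

/-- The normalized trace of the compression to the span of `e i`, `i ∈ s`. -/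
noncomputable def blockTrace (p : ℝ) [hp : Fact (1 ≤ p)] (he : Orthonormal ℂ e) (s : Finset ι) :
    SchattenClass p H →L[ℂ] ℂ :=
  LinearMap.mkContinuous
    { toFun := fun T => (s.card : ℂ)⁻¹ * ∑ i ∈ s, inner ℂ (e i) (T.toCLM (e i))
      map_add' := fun S T => by
        have h : (S + T).toCLM = S.toCLM + T.toCLM := rfl
        simp [h, Finset.sum_add_distrib, mul_add]
      map_smul' := fun c T => by
        have h : (c • T).toCLM = c • T.toCLM := rfl
        simp only [h, _root_.smul_apply, inner_smul_right, ← Finset.mul_sum, RingHom.id_apply,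
          smul_eq_mul]
        ring }
    ((s.card : ℝ) ^ (1 / p))⁻¹ fun T => by
      -- For the empty block the functional is 0 and only nonnegativity of the bound is needed;
      -- otherwise the powers of the cardinality can be divided.
      rcases s.eq_empty_or_nonempty with rfl | hs
      · simp only [LinearMap.coe_mk, AddHom.coe_mk, Finset.sum_empty, mul_zero, norm_zero]
        positivity
      have hc : (0 : ℝ) < s.card := by exact_mod_cast hs.card_pos
      simp only [LinearMap.coe_mk, AddHom.coe_mk, norm_mul, norm_inv, Complex.norm_natCast]
      refine (mul_le_mul_of_nonneg_left (norm_sum_inner_le_schattenNorm hp.out he s T.memSchatten)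
        (by positivity)).trans_eq ?_
      rw [Real.rpow_sub hc, Real.rpow_one, norm_def]
      field_simp

lemma blockTrace_apply (he : Orthonormal ℂ e) (s : Finset ι) (T : SchattenClass p H) :
    blockTrace p he s T = (s.card : ℂ)⁻¹ * ∑ i ∈ s, inner ℂ (e i) (T.toCLM (e i)) := rfl

lemma norm_blockTrace_le (he : Orthonormal ℂ e) (s : Finset ι) :
    ‖blockTrace p he s‖ ≤ ((s.card : ℝ) ^ (1 / p))⁻¹ :=
  LinearMap.mkContinuous_norm_le _ (by positivity) _

/-- The block projection as an element of the Schatten class. -/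
noncomputable def block (p : ℝ) [hp : Fact (1 ≤ p)] (he : Orthonormal ℂ e) (s : Finset ι) :
    SchattenClass p H :=
  ofMem (blockProj e s) (memSchatten_blockProj hp.out he s).1

lemma norm_block_le (he : Orthonormal ℂ e) (s : Finset ι) :
    ‖block p he s‖ ≤ (s.card : ℝ) ^ (1 / p) :=
  (memSchatten_blockProj hp.out he s).2

/-- Multiplication by a block projection, on either side, keeps the diagonal entries with index in t
and erases the others. For equal or disjoint blocks this is the eigenfunctional property. -/
lemma blockTrace_block_mul [DecidableEq ι] (he : Orthonormal ℂ e) (s t : Finset ι)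
    (T : SchattenClass p H) : blockTrace p he s (block p he t * T) =
      (s.card : ℂ)⁻¹ * ∑ i ∈ s, if i ∈ t then inner ℂ (e i) (T.toCLM (e i)) else 0 := by
  rw [blockTrace_apply]
  congr 1
  exact Finset.sum_congr rfl fun i _ => inner_blockProj he t i _

lemma blockTrace_mul_block [DecidableEq ι] (he : Orthonormal ℂ e) (s t : Finset ι)
    (T : SchattenClass p H) : blockTrace p he s (T * block p he t) =
      (s.card : ℂ)⁻¹ * ∑ i ∈ s, if i ∈ t then inner ℂ (e i) (T.toCLM (e i)) else 0 := by
  rw [blockTrace_apply]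
  congr 1
  refine Finset.sum_congr rfl fun i _ => ?_
  have h : (T * block p he t).toCLM (e i) = T.toCLM (blockProj e t (e i)) := rfl
  rw [h, blockProj_apply_self he]
  split_ifs <;> simp

lemma blockTrace_block [DecidableEq ι] (he : Orthonormal ℂ e) (s t : Finset ι) :
    blockTrace p he s (block p he t) = (s.card : ℂ)⁻¹ * ∑ i ∈ s, if i ∈ t then 1 else 0 := by
  rw [blockTrace_apply]
  congr 1
  refine Finset.sum_congr rfl fun i _ => ?_
  refine (inner_blockProj he t i _).trans ?_
  rw [inner_self_eq_norm_sq_to_K, he.1 i]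
  simp

end SchattenClass

end OrthonormalBlocks

/-! ### Application of the criterion to the Schatten class. -/

theorem theorem2p1 {H : Type u} [NormedAddCommGroup H] [InnerProductSpace ℂ H] [CompleteSpace H]
    (hH : ¬ FiniteDimensional ℂ H) (p : ℝ) [hp : Fact (1 ≤ p)] :
    ¬ ApproximatelyAmenable (SchattenClass p H) := by
  classical
  have hp0 : 0 < p := lt_of_lt_of_le one_pos hp.out
  -- The index records the block number, its colour and the position inside the block.
  obtain ⟨e, he⟩ := exists_orthonormal_of_not_finiteDimensional hH (ℕ × Bool × ℕ)
  -- Rounding p up keeps the rank an integer and still gives r_n^{1/p} ≥ 4^n.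
  set r : ℕ → ℕ := fun n => (4 ^ n) ^ ⌈p⌉₊ with hr
  set S : ℕ → Bool → Finset (ℕ × Bool × ℕ) := fun n s => {n} ×ˢ {s} ×ˢ Finset.range (r n) with hS
  have hcard : ∀ n s, (S n s).card = r n := fun n s => by simp [hS]
  have hr0 : ∀ n, (r n : ℂ) ≠ 0 := fun n => by simp [hr]
  -- Blocks coincide or are disjoint, so the diagonal masks in the trace formulas become
  -- all-or-nothing.
  have hmem : ∀ n s m t, ∀ i ∈ S n s, (i ∈ S m t ↔ n = m ∧ s = t) := by
    rintro n s m t ⟨n', s', i⟩ hi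
    simp only [hS, Finset.mem_product, Finset.mem_singleton, Finset.mem_range] at hi ⊢
    obtain ⟨rfl, rfl, hi⟩ := hi
    constructor
    · rintro ⟨rfl, rfl, _⟩
      exact ⟨rfl, rfl⟩
    · rintro ⟨rfl, rfl⟩
      exact ⟨rfl, rfl, hi⟩
  have hite : ∀ n s m t (g : ℕ × Bool × ℕ → ℂ),
      ((∑ i ∈ S n s, if i ∈ S m t then g i else 0) : ℂ) =
        if n = m ∧ s = t then ∑ i ∈ S n s, g i else 0 := by
    intro n s m t g
    rw [Finset.sum_congr rfl fun i hi => if_congr (hmem n s m t i hi) rfl rfl]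
    split_ifs <;> simp
  refine not_approximatelyAmenable_of_blocks (fun n s => SchattenClass.block p he (S n s))
    (fun n s => SchattenClass.blockTrace p he (S n s)) (fun n => (r n : ℝ) ^ (1 / p)) (fun n => ?_)
    (fun m n hmn => ?_) (fun n s => ?_) (fun n s => ?_) (fun n s m t c => ?_)
    (fun n s m t c => ?_) (fun n s m t => ?_)
  · rw [one_div, Real.le_rpow_inv_iff_of_pos (by positivity) (by positivity) hp0]
    have h : (r n : ℝ) = ((4 : ℝ) ^ n) ^ ((⌈p⌉₊ : ℕ) : ℝ) := by
      rw [Real.rpow_natCast]; simp [hr]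
    rw [h]
    exact Real.rpow_le_rpow_of_exponent_le (one_le_pow₀ (by norm_num)) (Nat.le_ceil p)
  · have : r m ≤ r n := Nat.pow_le_pow_left (Nat.pow_le_pow_right (by norm_num) hmn) _
    dsimp only
    gcongr
  · simpa only [hcard] using SchattenClass.norm_block_le (p := p) he (S n s)
  · simpa only [hcard] using SchattenClass.norm_blockTrace_le (p := p) he (S n s)
  · rw [SchattenClass.blockTrace_block_mul, hite, SchattenClass.blockTrace_apply]
    split_ifs <;> simp
  · rw [SchattenClass.blockTrace_mul_block, hite, SchattenClass.blockTrace_apply]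
    split_ifs <;> simp
  · rw [SchattenClass.blockTrace_block, hite, hcard]
    split_ifs
    · simp [hcard, hr0]
    · simp
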